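/- Let $d\ge 1$, let $\mathbb{E}$ be the set of unoriented edges $xy$ of $\mathbb{Z}^d$ with $\|x-y\|=1$ (Euclidean norm), and let $p\in[0,1]$ and $q\ge 1$ be real. For $n\ge 0$ let $\Lambda_n=[-n,n]^d\cap\mathbb{Z}^d$, let $E_n$ be the set of edges of $\mathbb{E}$ with both endpoints in $\Lambda_n$, and let $\partial\Lambda_n$ be the set of vertices of $\Lambda_n$ that are an endpoint of an edge in $\mathbb{E}\setminus E_n$. For $\#\in\{0,1\}$ let $\phi^{\#}_{\Lambda_n,p,q}$ be the probability measure on $\{0,1\}^{E_n}$ with $$\phi^{\#}_{\Lambda_n,p,q}[\omega]=\frac{p^{o(\omega)}(1-p)^{c(\omega)}q^{k(\omega^{\#})}}{Z^{\#}_{\Lambda_n,p,q}},$$ where $o(\omega)$ and $c(\omega)$ are the numbers of edges with $\omega_e=1$ (open) and $\omega_e=0$ (closed), $k(\omega^{0})$ is the number of connected components (isolated vertices included) of the graph with vertex set $\Lambda_n$ and the open edges of $\omega$ (free boundary conditions), $k(\omega^1)$ is the same number after all vertices of $\partial\Lambda_n$ have been identified to a single vertex (wired boundary conditions), and $Z^{\#}_{\Lambda_n,p,q}$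 is the normalizing constant. For each $\#\in\{0,1\}$ there is a unique probability measure $\phi^{\#}_{p,q}$ on $\{0,1\}^{\mathbb{E}}$ (with the product $\sigma$-algebra) such that $\lim_{n\to\infty}\phi^{\#}_{\Lambda_n,p,q}[\mathcal{A}]=\phi^{\#}_{p,q}[\mathcal{A}]$ for every event $\mathcal{A}$ depending on finitely many edges; it is called the infinite-volume random-cluster measure with free ($\#=0$) or wired ($\#=1$) boundary conditions. Call the connected components of the graph formed by $\mathbb{Z}^d$ and the open edges of $\omega\in\{0,1\}^{\mathbb{E}}$ the clusters of $\omega$. Then, for each $\#\in\{0,1\}$, at least one of the following holds: 1. $\phi^{\#}_{p,q}[\text{the cluster of }0\text{ is infinite}]=0$, and $\phi^{\#}_{p,q}$-almost surely there is no infinite cluster; 2. $\phi^{\#}_{p,q}$-almost surely there is exactly one infinite cluster. -/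

import Mathlib

open MeasureTheory Filter Topology

namespace RandomCluster

/-- The vertices of the lattice `ℤ^d`. -/
abbrev Vertex (d : ℕ) : Type := Fin d → ℤ

/-- The nearest-neighbour lattice: `x` and `y` are joined by an edge when their Euclidean distance
is `1`, i.e. when the squared distance is `1`. -/
def lattice (d : ℕ) : SimpleGraph (Vertex d) where
  Adj x y := ∑ i, (x i - y i) ^ 2 = 1
  symm := ⟨fun x y h => by
    rw [← h]
    exact Finset.sum_congr rfl fun i _ => by ring⟩
  loopless := ⟨fun x h => by simp at h⟩

/-- The edges of `ℤ^d` (unoriented). -/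
abbrev Edge (d : ℕ) : Type := (lattice d).edgeSet

/-- Percolation configurations on `ℤ^d`, with the product sigma-algebra; `true` means open. -/
abbrev Config (d : ℕ) : Type := Edge d → Bool

/-- The graph on `ℤ^d` whose edges are the open edges of `ω`. -/
def openGraph {d : ℕ} (ω : Config d) : SimpleGraph (Vertex d) :=
  SimpleGraph.fromRel fun x y => ∃ h : s(x, y) ∈ (lattice d).edgeSet, ω ⟨s(x, y), h⟩ = true

/-- The clusters of `ω` are the connected components of its open graph. -/
abbrev Cluster {d : ℕ} (ω : Config d) : Type := (openGraph ω).ConnectedComponent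

/-- The vertex `x` is connected to infinity: its cluster is infinite. -/
def ConnectedToInfinity {d : ℕ} (ω : Config d) (x : Vertex d) : Prop :=
  ((openGraph ω).connectedComponentMk x).supp.Infinite

/-! ### Finite-volume measures, on a finite subgraph `G` of `ℤ^d` -/

/-- The vertices of `G` that are an endpoint of some lattice edge that is not an edge of `G`. -/
def boundary {d : ℕ} (G : (lattice d).Subgraph) : Set (Vertex d) :=
  {x | x ∈ G.verts ∧ ∃ y, (lattice d).Adj x y ∧ ¬ G.Adj x y}

/-- A graph on the vertices of `G` with the same clusters as the contracted graph `ω^ξ`. The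
boundary condition `ξ` is a partition of the boundary of `G`; instead of contracting each block to a
point, any two vertices of a block are joined by an edge. -/
def gluedGraph {d : ℕ} (G : (lattice d).Subgraph) (ξ : Setoid (boundary G))
    (ω : G.edgeSet → Bool) : SimpleGraph G.verts :=
  SimpleGraph.fromRel fun x y =>
    (∃ h : s(x.1, y.1) ∈ G.edgeSet, ω ⟨s(x.1, y.1), h⟩ = true) ∨
    (∃ (hx : x.1 ∈ boundary G) (hy : y.1 ∈ boundary G), ξ ⟨x.1, hx⟩ ⟨y.1, hy⟩)

/-- The number `k(ω^ξ)` of clusters, isolated vertices included. -/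
noncomputable def numClusters {d : ℕ} (G : (lattice d).Subgraph) (ξ : Setoid (boundary G))
    (ω : G.edgeSet → Bool) : ℕ :=
  Nat.card (gluedGraph G ξ ω).ConnectedComponent

/-- The weight `p^{o(ω)} (1-p)^{c(ω)} q^{k(ω^ξ)}`. -/
noncomputable def weight {d : ℕ} (G : (lattice d).Subgraph) (ξ : Setoid (boundary G)) (p q : ℝ)
    (ω : G.edgeSet → Bool) : ℝ :=
  p ^ Nat.card {e // ω e = true} * (1 - p) ^ Nat.card {e // ω e = false} * q ^ numClusters G ξ ω

/-- The partition function (the sum is finite when `G` is finite). -/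
noncomputable def partitionFunction {d : ℕ} (G : (lattice d).Subgraph) (ξ : Setoid (boundary G))
    (p q : ℝ) : ℝ :=
  ∑' ω : G.edgeSet → Bool, weight G ξ p q ω

/-- The random-cluster measure on `G` with edge-weight `p`, cluster-weight `q` and boundary
condition `ξ`: each configuration `ω` on `G` has mass `weight ω / Z`. -/
noncomputable def finiteMeasure {d : ℕ} (G : (lattice d).Subgraph) (ξ : Setoid (boundary G))
    (p q : ℝ) : Measure (G.edgeSet → Bool) :=
  Measure.sum fun ω =>
    ENNReal.ofReal (weight G ξ p q ω / partitionFunction G ξ p q) • Measure.dirac ω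

/-! ### Infinite-volume measures -/

/-- The box `Λ_n = [-n, n]^d ∩ ℤ^d`, with all lattice edges between two of its vertices. -/
def box (d n : ℕ) : (lattice d).Subgraph :=
  (⊤ : (lattice d).Subgraph).induce {x | ∀ i, -(n : ℤ) ≤ x i ∧ x i ≤ n}

/-- The two types of boundary conditions. -/
inductive BoundaryType : Type
  | free
  | wired

/-- Free: the partition of the boundary into singletons. Wired: the partition with one block. -/
def BoundaryType.toSetoid {d : ℕ} (b : BoundaryType) (G : (lattice d).Subgraph) :
    Setoid (boundary G) :=
  match b with
  | .free => ⊥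
  | .wired => ⊤

open Classical in
/-- A configuration on `G`, seen as a configuration on `ℤ^d` that is closed off `G`. -/
noncomputable def extend {d : ℕ} (G : (lattice d).Subgraph) (ω : G.edgeSet → Bool) : Config d :=
  fun e => if h : e.1 ∈ G.edgeSet then ω ⟨e.1, h⟩ else false

/-- The event `A` depends on finitely many edges only. -/
def DependsOnFinitelyManyEdges {d : ℕ} (A : Set (Config d)) : Prop :=
  ∃ F : Finset (Edge d), ∀ ω ω' : Config d, (∀ e ∈ F, ω e = ω' e) → (ω ∈ A ↔ ω' ∈ A)

/-- `φ` is the infinite-volume random-cluster measure on `ℤ^d` with free (resp. wired) boundary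
conditions: a probability measure such that `φ_{Λ_n,p,q}[A] → φ[A]` for each event `A` that depends
on finitely many edges. The value of `extend` off `Λ_n` does not matter here: it has no influence
on `A` as soon as `Λ_n` contains the edges on which `A` depends. -/
structure IsInfiniteVolumeMeasure {d : ℕ} (b : BoundaryType) (p q : ℝ)
    (φ : Measure (Config d)) : Prop where
  isProbabilityMeasure : IsProbabilityMeasure φ
  tendsto : ∀ A : Set (Config d), DependsOnFinitelyManyEdges A →
    Tendsto (fun n : ℕ => finiteMeasure (box d n) (b.toSetoid (box d n)) p q
      (extend (box d n) ⁻¹' A)) atTop (𝓝 (φ A))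

end RandomCluster

namespace RandomCluster

variable {d : ℕ}

/-! Existence of the infinite-volume measure rests on positive association; uniqueness of the
infinite cluster is the Burton-Keane argument.

The number of clusters is treated as a dimension, that of the space of rational functions constant
on clusters. The formula dim(U + V) + dim(U ∩ V) = dim U + dim V makes it supermodular
(`clusterRank_supermodular`), so for q ≥ 1 the weights satisfy the lattice condition, and the four
functions theorem gives the Holley and FKG inequalities. Consider the events that all edges of a
finite set have the state imposed outside the domain (closed for free, open for wired). Their
probabilities decrease as the domain grows (`prob_agreeEvent_antitone`), hence converge;
inclusion-exclusion extends this to all cylinder events, and compactness of the configuration space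
yields a measure.

The limit, taken along all finite edge sets, is invariant under lattice automorphisms. It is also
mixing (`tendsto_limitProb_inter_moveEdges`): FKG bounds the joint probability of such an event and
a distant translate of another from below by the product, and passing to a domain made of two
distant pieces, where the measure factorises, bounds it from above. So translation-invariant events
have probability 0 or 1; this is applied to the existence and to the uniqueness of an infinite
cluster.

Suppose that p > 0 and that almost surely an infinite cluster exists but is not unique. Opening
finitely many edges cannot send an event of positive probability into a null set
(`measure_preimage_update_eq_zero`). With at most two infinite clusters, opening all edges at a
finite connected set that meets them would produce exactly one; hence there are at least three, and
the same operation produces a trifurcation, a finite connected set whose removal leaves three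
infinite branches. But disjoint trifurcations in a box are at most as numerous as the vertices of a
surrounding sphere (`card_trifurcation_le`), whereas by invariance their expected number would grow
like the volume, so they have probability zero. For p = 0 all edges are closed. -/

lemma openGraph_adj {ω : Config d} {x y : Vertex d} :
    (openGraph ω).Adj x y ↔ ∃ h : s(x, y) ∈ (lattice d).edgeSet, ω ⟨s(x, y), h⟩ = true := by
  unfold openGraph
  rw [SimpleGraph.fromRel_adj]
  constructor
  · rintro ⟨-, h | ⟨h, h'⟩⟩
    · exact h
    · have e : s(y, x) = s(x, y) := Sym2.eq_swap
      exact ⟨e ▸ h, by simpa only [e] using h'⟩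
  · rintro ⟨h, h'⟩
    exact ⟨(lattice d).ne_of_adj (by simpa using h), Or.inl ⟨h, h'⟩⟩

lemma openGraph_le_lattice (ω : Config d) : openGraph ω ≤ lattice d := fun x y h => by
  obtain ⟨h, -⟩ := openGraph_adj.1 h
  simpa using h

lemma openGraph_mono {ω ω' : Config d} (h : ω ≤ ω') : openGraph ω ≤ openGraph ω' := fun x y => by
  simp only [openGraph_adj]
  rintro ⟨h1, h2⟩
  exact ⟨h1, (Bool.le_iff_imp.1 (h _)) h2⟩

/-! ### Functions that are constant on clusters -/

/-- The rational functions that vanish off `T` and are constant on the clusters of `ω`. -/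
def clusterFunctions (T : Finset (Vertex d)) (ω : Config d) : Submodule ℚ (Vertex d → ℚ) where
  carrier := {f | (∀ x ∉ T, f x = 0) ∧ ∀ x y, (openGraph ω).Adj x y → f x = f y}
  add_mem' := fun {f g} hf hg =>
    ⟨fun x hx => by simp [hf.1 x hx, hg.1 x hx],
      fun x y h => by simp [hf.2 x y h, hg.2 x y h]⟩
  zero_mem' := ⟨fun _ _ => rfl, fun _ _ _ => rfl⟩
  smul_mem' := fun c f hf =>
    ⟨fun x hx => by simp [hf.1 x hx], fun x y h => by simp [hf.2 x y h]⟩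

lemma mem_clusterFunctions {T : Finset (Vertex d)} {ω : Config d} {f : Vertex d → ℚ} :
    f ∈ clusterFunctions T ω ↔
      (∀ x ∉ T, f x = 0) ∧ ∀ x y, (openGraph ω).Adj x y → f x = f y := Iff.rfl

lemma finite_of_support (T : Finset (Vertex d)) (X : Submodule ℚ (Vertex d → ℚ))
    (hX : ∀ f ∈ X, ∀ x ∉ T, f x = 0) : Module.Finite ℚ X := by
  let φ : X →ₗ[ℚ] (T → ℚ) := (LinearMap.funLeft ℚ ℚ ((↑) : T → Vertex d)).comp X.subtype
  refine Module.Finite.of_injective φ fun f g h => ?_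
  ext x
  by_cases hx : x ∈ T
  · exact congrFun h ⟨x, hx⟩
  · rw [hX _ f.2 x hx, hX _ g.2 x hx]

instance (T : Finset (Vertex d)) (ω : Config d) : Module.Finite ℚ (clusterFunctions T ω) :=
  finite_of_support T _ fun _ hf => hf.1

/-- The dimension of the space of functions that vanish off `T` and are constant on clusters. -/
noncomputable def clusterRank (T : Finset (Vertex d)) (ω : Config d) : ℕ :=
  Module.finrank ℚ (clusterFunctions T ω)

/-- By the dimension formula for the spaces of `a` on `T'` and of `b` on `T`: their sum lies in the
space of `a ⊓ b` on `T'`, their intersection in that of `a ⊔ b` on `T`. Two different supports are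
allowed so that two wired domains can be compared. -/
lemma clusterRank_supermodular {T T' : Finset (Vertex d)} (hT : T ⊆ T') (a b : Config d) :
    clusterRank T' a + clusterRank T b ≤ clusterRank T' (a ⊓ b) + clusterRank T (a ⊔ b) := by
  unfold clusterRank
  rw [← Submodule.finrank_sup_add_finrank_inf_eq]
  refine add_le_add (Submodule.finrank_mono (sup_le ?_ ?_)) (Submodule.finrank_mono ?_)
  · exact fun f hf => ⟨hf.1, fun x y h => hf.2 x y (openGraph_mono inf_le_left h)⟩
  · exact fun f hf => ⟨fun x hx => hf.1 x fun h => hx (hT h),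
      fun x y h => hf.2 x y (openGraph_mono inf_le_right h)⟩
  · rintro f ⟨ha, hb⟩
    refine ⟨hb.1, fun x y h => ?_⟩
    obtain ⟨h1, h2⟩ := openGraph_adj.1 h
    rcases (Bool.or_eq_true_iff).1 h2 with h2 | h2
    · exact ha.2 x y (openGraph_adj.2 ⟨h1, h2⟩)
    · exact hb.2 x y (openGraph_adj.2 ⟨h1, h2⟩)

/-- An edge with no endpoint in `T` joins two vertices where the functions vanish, so it imposes no
condition. -/
lemma clusterRank_congr {T : Finset (Vertex d)} {ω ω' : Config d}
    (h : ∀ e : Edge d, ∀ x ∈ T, x ∈ e.1 → ω e = ω' e) : clusterRank T ω = clusterRank T ω' := by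
  have key : ∀ {ω ω' : Config d}, (∀ e : Edge d, ∀ x ∈ T, x ∈ e.1 → ω e = ω' e) →
      clusterFunctions T ω ≤ clusterFunctions T ω' := by
    intro ω ω' h f hf
    refine ⟨hf.1, fun x y hxy => ?_⟩
    obtain ⟨h1, h2⟩ := openGraph_adj.1 hxy
    by_cases hx : x ∈ T
    · exact hf.2 x y (openGraph_adj.2 ⟨h1, by rw [h _ x hx (by simp), h2]⟩)
    · by_cases hy : y ∈ T
      · exact hf.2 x y (openGraph_adj.2 ⟨h1, by rw [h _ y hy (by simp), h2]⟩)
      · rw [hf.1 x hx, hf.1 y hy]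
  unfold clusterRank
  rw [le_antisymm (key h) (key fun e x hx hxe => (h e x hx hxe).symm)]

/-- Cutting a function off to `T₁` and to `T₂` preserves constancy on clusters, since no open edge
joins the two sets; the space is a direct sum. -/
lemma clusterRank_union [DecidableEq (Vertex d)] {T₁ T₂ : Finset (Vertex d)} {ω : Config d}
    (hT : Disjoint T₁ T₂)
    (h : ∀ x ∈ T₁, ∀ y ∈ T₂, ¬ (openGraph ω).Adj x y) :
    clusterRank (T₁ ∪ T₂) ω = clusterRank T₁ ω + clusterRank T₂ ω := by
  unfold clusterRank
  have hinf : clusterFunctions T₁ ω ⊓ clusterFunctions T₂ ω = ⊥ := by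
    rw [eq_bot_iff]
    rintro f ⟨h1, h2⟩
    rw [Submodule.mem_bot]
    ext x
    by_cases hx : x ∈ T₁
    · exact h2.1 x (Finset.disjoint_left.1 hT hx)
    · exact h1.1 x hx
  have hsup : clusterFunctions (T₁ ∪ T₂) ω = clusterFunctions T₁ ω ⊔ clusterFunctions T₂ ω := by
    apply le_antisymm
    · intro f hf
      have key : ∀ T T' : Finset (Vertex d), (∀ x ∉ T ∪ T', f x = 0) →
          (∀ x ∈ T, ∀ y ∈ T', ¬ (openGraph ω).Adj x y) →
          (fun x => if x ∈ T then f x else 0) ∈ clusterFunctions T ω := by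
        intro T T' h0 hn
        refine ⟨fun x hx => by simp [hx], fun x y hxy => ?_⟩
        by_cases hx : x ∈ T <;> by_cases hy : y ∈ T
        · simp [hx, hy, hf.2 x y hxy]
        · have : f y = 0 := h0 y fun hy' => (Finset.mem_union.1 hy').elim hy fun h' => hn x hx y h' hxy
          simp [hx, hy, hf.2 x y hxy, this]
        · have : f x = 0 :=
            h0 x fun hx' => (Finset.mem_union.1 hx').elim hx fun h' => hn y hy x h' hxy.symm
          simp [hx, hy, ← hf.2 x y hxy, this]
        · simp [hx, hy]
      refine Submodule.mem_sup.2 ⟨_, key T₁ T₂ hf.1 h, _,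
        key T₂ T₁ (by rw [Finset.union_comm]; exact hf.1) fun x hx y hy hxy => h y hy x hx hxy.symm, ?_⟩
      ext x
      by_cases h1 : x ∈ T₁
      · simp [h1, Finset.disjoint_left.1 hT h1]
      · by_cases h2 : x ∈ T₂
        · simp [h1, h2]
        · simp [h1, h2, hf.1 x (by simp [h1, h2])]
    · refine sup_le (fun f hf => ⟨fun x hx => hf.1 x ?_, hf.2⟩)
        (fun f hf => ⟨fun x hx => hf.1 x ?_, hf.2⟩) <;> simp_all
  rw [hsup, ← Submodule.finrank_sup_add_finrank_inf_eq, hinf]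
  simp

/-- Opening the edge `uv` adds the single linear condition `f u = f v`, and the kernel of one linear
form has codimension at most one. -/
lemma clusterRank_le_update [DecidableEq (Edge d)] (T : Finset (Vertex d)) (ω : Config d)
    (e : Edge d) : clusterRank T ω ≤ clusterRank T (Function.update ω e true) + 1 := by
  obtain ⟨e, he⟩ := e
  induction e with
  | h u v =>
  let φ : clusterFunctions T ω →ₗ[ℚ] ℚ :=
    ((LinearMap.proj u : (Vertex d → ℚ) →ₗ[ℚ] ℚ) - LinearMap.proj v).comp
      (clusterFunctions T ω).subtype
  have h1 := φ.finrank_range_add_finrank_ker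
  have h2 : Module.finrank ℚ (LinearMap.range φ) ≤ 1 := by
    simpa using Submodule.finrank_le (LinearMap.range φ)
  have h3 : Module.finrank ℚ (LinearMap.ker φ) ≤
      clusterRank T (Function.update ω ⟨s(u, v), he⟩ true) := by
    let ψ : LinearMap.ker φ →ₗ[ℚ] clusterFunctions T (Function.update ω ⟨s(u, v), he⟩ true) :=
      LinearMap.codRestrict _ ((clusterFunctions T ω).subtype.comp (LinearMap.ker φ).subtype) (by
        rintro ⟨⟨f, hf⟩, hfφ⟩
        refine ⟨hf.1, fun x y hxy => ?_⟩
        obtain ⟨h4, h5⟩ := openGraph_adj.1 hxy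
        have huv : f u = f v := by
          have : f u - f v = 0 := hfφ
          linarith
        by_cases hc : s(x, y) = s(u, v)
        · rcases Sym2.eq_iff.1 hc with ⟨rfl, rfl⟩ | ⟨rfl, rfl⟩
          · exact huv
          · exact huv.symm
        · rw [Function.update_of_ne (by simpa [Subtype.ext_iff] using hc)] at h5
          exact hf.2 x y (openGraph_adj.2 ⟨h4, h5⟩))
    refine LinearMap.finrank_le_finrank_of_injective (f := ψ) fun f g hfg => ?_
    ext x
    exact congrFun (congrArg Subtype.val hfg) x
  unfold clusterRank at h3 ⊢
  omega

/-! ### The number of clusters as a dimension -/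

/-- Functions on the set of components correspond to functions constant along edges. The space `X`
is a parameter, described by its members, so that one statement serves both boundary conditions. -/
lemma card_connectedComponent_eq_finrank {T : Finset (Vertex d)} {V : Set (Vertex d)}
    (hV : ∀ x, x ∈ V ↔ x ∈ T) (H : SimpleGraph V)
    (X : Submodule ℚ (Vertex d → ℚ))
    (hX : ∀ f, f ∈ X ↔ (∀ x ∉ T, f x = 0) ∧ ∀ x y : V, H.Adj x y → f x = f y) :
    Nat.card H.ConnectedComponent = Module.finrank ℚ X := by
  classical
  have : Finite V := Finite.of_injective (fun x : V => (⟨x.1, (hV _).1 x.2⟩ : T))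
    fun x y h => Subtype.ext (by simpa using h)
  have : Fintype H.ConnectedComponent := Fintype.ofFinite _
  rw [Nat.card_eq_fintype_card, ← Module.finrank_fintype_fun_eq_card ℚ]
  let φ : (H.ConnectedComponent → ℚ) →ₗ[ℚ] (Vertex d → ℚ) :=
    { toFun := fun g x => if h : x ∈ V then g (H.connectedComponentMk ⟨x, h⟩) else 0
      map_add' := fun g g' => by ext x; by_cases h : x ∈ V <;> simp [h]
      map_smul' := fun c g => by ext x; by_cases h : x ∈ V <;> simp [h] }
  have hφ : Function.Injective φ := by
    intro g g' h
    ext C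
    induction C using SimpleGraph.ConnectedComponent.ind with
    | h v => simpa [φ] using congrFun h v.1
  have hr : LinearMap.range φ = X := by
    ext f
    rw [hX]
    constructor
    · rintro ⟨g, rfl⟩
      refine ⟨fun x hx => by simp [φ, hV, hx], fun x y h => ?_⟩
      have := SimpleGraph.ConnectedComponent.connectedComponentMk_eq_of_adj h
      simp [φ, this]
    · rintro ⟨h0, h1⟩
      refine ⟨fun C => C.lift (fun v => f v.1) ?_, ?_⟩
      · intro v w p hp
        induction p with
        | nil => rfl
        | cons h p ih => rw [h1 _ _ h]; exact ih hp.of_cons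
      · ext x
        by_cases h : x ∈ V
        · simp [φ, h]
        · simp [φ, h, h0 x (fun h' => h ((hV x).2 h'))]
  rw [← hr, LinearMap.finrank_range_of_inj hφ]

/-! ### Random-cluster weights with varying edge parameters, Holley and FKG inequalities -/

/-- The configurations that are equal to `s` at every edge off `S`. -/
noncomputable def configs (s : Bool) (S : Finset (Edge d)) : Finset (Config d) :=
  Set.Finite.toFinset (s := {ω : Config d | ∀ e ∉ S, ω e = s}) (by
    refine Set.Finite.of_finite_image (f := fun (ω : Config d) (e : S) => ω e)
      (Set.toFinite _) fun ω hω ω' hω' h => ?_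
    ext e
    by_cases he : e ∈ S
    · exact congrArg (· = true) (congrFun h ⟨e, he⟩) |> fun h => by simpa using h
    · rw [hω e he, hω' e he])

@[simp] lemma mem_configs {s : Bool} {S : Finset (Edge d)} {ω : Config d} :
    ω ∈ configs s S ↔ ∀ e ∉ S, ω e = s := by simp [configs]

lemma configs_mono (s : Bool) {S R : Finset (Edge d)} (h : S ⊆ R) : configs s S ⊆ configs s R := by
  intro ω hω
  rw [mem_configs] at hω ⊢
  exact fun e he => hω e fun h' => he (h h')

/-- The factor of one edge with parameter `r`. -/
def edgeWeight (r : ℝ) (x : Bool) : ℝ := if x then r else 1 - r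

/-- The random-cluster weight with parameter `r e` at the edges `e ∈ S`. -/
noncomputable def rcWeight (S : Finset (Edge d)) (r : Edge d → ℝ) (q : ℝ) (T : Finset (Vertex d))
    (ω : Config d) : ℝ :=
  (∏ e ∈ S, edgeWeight (r e) (ω e)) * q ^ clusterRank T ω

lemma edgeWeight_nonneg {r : ℝ} (hr : r ∈ Set.Icc (0 : ℝ) 1) (x : Bool) : 0 ≤ edgeWeight r x := by
  obtain ⟨h0, h1⟩ := hr
  unfold edgeWeight
  split_ifs <;> linarith

lemma rcWeight_nonneg {S : Finset (Edge d)} {r : Edge d → ℝ} {q : ℝ}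
    (hr : ∀ e, r e ∈ Set.Icc (0 : ℝ) 1) (hq : 1 ≤ q) (T : Finset (Vertex d)) (ω : Config d) :
    0 ≤ rcWeight S r q T ω :=
  mul_nonneg (Finset.prod_nonneg fun e _ => edgeWeight_nonneg (hr e) _) (by positivity)

/-- The edge factors are compared one edge at a time; the cluster factor is supermodularity of the
rank together with `q ≥ 1`. -/
lemma rcWeight_lattice {S : Finset (Edge d)} {r r' : Edge d → ℝ} {q : ℝ}
    (hr : ∀ e, r e ∈ Set.Icc (0 : ℝ) 1) (hr' : ∀ e, r' e ∈ Set.Icc (0 : ℝ) 1)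
    (hrr : ∀ e, r e ≤ r' e) (hq : 1 ≤ q) {T T' : Finset (Vertex d)} (hT : T' ⊆ T)
    (a b : Config d) :
    rcWeight S r q T a * rcWeight S r' q T' b ≤
      rcWeight S r q T (a ⊓ b) * rcWeight S r' q T' (a ⊔ b) := by
  unfold rcWeight
  rw [mul_mul_mul_comm, mul_mul_mul_comm (∏ e ∈ S, edgeWeight (r e) ((a ⊓ b) e)),
    ← Finset.prod_mul_distrib, ← Finset.prod_mul_distrib, ← pow_add, ← pow_add]
  refine mul_le_mul (Finset.prod_le_prod (fun e _ => mul_nonneg (edgeWeight_nonneg (hr e) _)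
    (edgeWeight_nonneg (hr' e) _)) fun e _ => ?_)
    (pow_le_pow_right₀ hq (clusterRank_supermodular hT a b)) (by positivity)
    (Finset.prod_nonneg fun e _ => mul_nonneg (edgeWeight_nonneg (hr e) _)
      (edgeWeight_nonneg (hr' e) _))
  rw [Pi.inf_apply, Pi.sup_apply]
  -- Equality except when `a e` is open and `b e` closed, where `r (1 - r') ≤ (1 - r) r'` amounts to
  -- `r ≤ r'`.
  cases a e <;> cases b e <;> (simp [edgeWeight]; try nlinarith [hrr e])

section Inequalities

variable {s : Bool} {S : Finset (Edge d)} {r r' : Edge d → ℝ} {q : ℝ} {T T' : Finset (Vertex d)}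

open Classical in
/-- The total weight of the configurations in the event `A`. -/
noncomputable def rcSum (s : Bool) (S : Finset (Edge d)) (r : Edge d → ℝ) (q : ℝ)
    (T : Finset (Vertex d)) (A : Set (Config d)) : ℝ :=
  ∑ ω ∈ configs s S with ω ∈ A, rcWeight S r q T ω

lemma rcSum_eq_sum_indicator (A : Set (Config d)) :
    rcSum s S r q T A = ∑ ω ∈ configs s S, A.indicator (rcWeight S r q T) ω := by
  classical
  simp only [rcSum, Finset.sum_filter, Set.indicator_apply]

lemma four_functions_configs {f₁ f₂ f₃ f₄ : Config d → ℝ} (h₁ : 0 ≤ f₁) (h₂ : 0 ≤ f₂)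
    (h₃ : 0 ≤ f₃) (h₄ : 0 ≤ f₄) (h : ∀ a b, f₁ a * f₂ b ≤ f₃ (a ⊓ b) * f₄ (a ⊔ b)) :
    (∑ ω ∈ configs s S, f₁ ω) * ∑ ω ∈ configs s S, f₂ ω ≤
      (∑ ω ∈ configs s S, f₃ ω) * ∑ ω ∈ configs s S, f₄ ω := by
  classical
  refine (four_functions_theorem f₁ f₂ f₃ f₄ h₁ h₂ h₃ h₄ h (configs s S) (configs s S)).trans ?_
  refine mul_le_mul (Finset.sum_le_sum_of_subset_of_nonneg ?_ fun ω _ _ => h₃ ω)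
    (Finset.sum_le_sum_of_subset_of_nonneg ?_ fun ω _ _ => h₄ ω)
    (Finset.sum_nonneg fun ω _ => h₄ ω) (Finset.sum_nonneg fun ω _ => h₃ ω)
  · refine Finset.infs_subset_iff.2 fun a ha b hb => ?_
    rw [mem_configs] at ha hb ⊢
    intro e he
    simp [ha e he, hb e he]
  · refine Finset.sups_subset_iff.2 fun a ha b hb => ?_
    rw [mem_configs] at ha hb ⊢
    intro e he
    simp [ha e he, hb e he]

variable (hr : ∀ e, r e ∈ Set.Icc (0 : ℝ) 1) (hr' : ∀ e, r' e ∈ Set.Icc (0 : ℝ) 1)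
  (hrr : ∀ e, r e ≤ r' e) (hq : 1 ≤ q) (hT : T' ⊆ T)

include hr hr' hrr hq hT in
-- The four functions theorem applied to the weights restricted to `A`, `B`, everything and `A ∩ B`.
-- With `B = Set.univ` it is Holley's stochastic domination; with equal parameters and supports it
-- is the FKG inequality.
lemma rcSum_mul_le_of_isUpperSet {A B : Set (Config d)} (hA : IsUpperSet A) (hB : IsUpperSet B) :
    rcSum s S r q T A * rcSum s S r' q T' B ≤
      rcSum s S r q T Set.univ * rcSum s S r' q T' (A ∩ B) := by
  classical
  simp only [rcSum_eq_sum_indicator]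
  have n1 : ∀ ω, 0 ≤ rcWeight S r q T ω := rcWeight_nonneg hr hq T
  have n2 : ∀ ω, 0 ≤ rcWeight S r' q T' ω := rcWeight_nonneg hr' hq T'
  refine four_functions_configs (fun ω => Set.indicator_nonneg (fun ω _ => n1 ω) ω)
    (fun ω => Set.indicator_nonneg (fun ω _ => n2 ω) ω)
    (fun ω => Set.indicator_nonneg (fun ω _ => n1 ω) ω)
    (fun ω => Set.indicator_nonneg (fun ω _ => n2 ω) ω) fun a b => ?_
  by_cases ha : a ∈ A
  · by_cases hb : b ∈ B
    · rw [Set.indicator_of_mem ha, Set.indicator_of_mem hb, Set.indicator_of_mem (Set.mem_univ _),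
        Set.indicator_of_mem (Set.mem_inter (hA le_sup_left ha) (hB le_sup_right hb))]
      exact rcWeight_lattice hr hr' hrr hq hT a b
    · rw [Set.indicator_of_notMem hb, mul_zero]
      exact mul_nonneg (Set.indicator_nonneg (fun ω _ => n1 ω) _)
        (Set.indicator_nonneg (fun ω _ => n2 ω) _)
  · rw [Set.indicator_of_notMem ha, zero_mul]
    exact mul_nonneg (Set.indicator_nonneg (fun ω _ => n1 ω) _)
      (Set.indicator_nonneg (fun ω _ => n2 ω) _)

include hr hr' hrr hq hT in
lemma rcSum_mul_le_of_isLowerSet {A B : Set (Config d)} (hA : IsLowerSet A) (hB : IsLowerSet B) :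
    rcSum s S r q T A * rcSum s S r' q T' B ≤
      rcSum s S r q T (A ∩ B) * rcSum s S r' q T' Set.univ := by
  classical
  simp only [rcSum_eq_sum_indicator]
  have n1 : ∀ ω, 0 ≤ rcWeight S r q T ω := rcWeight_nonneg hr hq T
  have n2 : ∀ ω, 0 ≤ rcWeight S r' q T' ω := rcWeight_nonneg hr' hq T'
  refine four_functions_configs (fun ω => Set.indicator_nonneg (fun ω _ => n1 ω) ω)
    (fun ω => Set.indicator_nonneg (fun ω _ => n2 ω) ω)
    (fun ω => Set.indicator_nonneg (fun ω _ => n1 ω) ω)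
    (fun ω => Set.indicator_nonneg (fun ω _ => n2 ω) ω) fun a b => ?_
  by_cases ha : a ∈ A
  · by_cases hb : b ∈ B
    · rw [Set.indicator_of_mem ha, Set.indicator_of_mem hb, Set.indicator_of_mem (Set.mem_univ _),
        Set.indicator_of_mem (Set.mem_inter (hA inf_le_left ha) (hB inf_le_right hb))]
      exact rcWeight_lattice hr hr' hrr hq hT a b
    · rw [Set.indicator_of_notMem hb, mul_zero]
      exact mul_nonneg (Set.indicator_nonneg (fun ω _ => n1 ω) _)
        (Set.indicator_nonneg (fun ω _ => n2 ω) _)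
  · rw [Set.indicator_of_notMem ha, zero_mul]
    exact mul_nonneg (Set.indicator_nonneg (fun ω _ => n1 ω) _)
      (Set.indicator_nonneg (fun ω _ => n2 ω) _)

include hr hq in
lemma rcSum_nonneg (A : Set (Config d)) : 0 ≤ rcSum s S r q T A :=
  Finset.sum_nonneg fun _ _ => rcWeight_nonneg hr hq _ _

include hr hq in
lemma rcSum_univ_pos : 0 < rcSum s S r q T Set.univ := by
  classical
  -- A configuration of positive weight: an edge is open when its parameter is positive, and
  -- otherwise closed with positive factor `1 - r e`.
  let ω : Config d := fun e => if e ∈ S then decide (0 < r e) else s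
  have h1 : ω ∈ configs s S := by
    rw [mem_configs]
    exact fun e he => by simp [ω, he]
  have h2 : 0 < rcWeight S r q T ω := by
    refine mul_pos (Finset.prod_pos fun e he => ?_) (by positivity)
    simp only [edgeWeight, ω, he, if_true, decide_eq_true_eq]
    split_ifs with h
    · exact h
    · linarith
  refine h2.trans_le ?_
  rw [rcSum_eq_sum_indicator]
  simpa using Finset.single_le_sum (f := fun ω => Set.univ.indicator (rcWeight S r q T) ω)
    (fun ω _ => Set.indicator_nonneg (fun ω _ => rcWeight_nonneg hr hq T ω) ω) h1

end Inequalities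

/-! ### Finite-volume measures on finite sets of edges -/

/-- The state of the edges outside of the domain: closed for free, open for wired boundary
conditions. -/
def BoundaryType.state : BoundaryType → Bool
  | .free => false
  | .wired => true

open Classical in
/-- The endpoints of the edges in `S`. -/
noncomputable def endpoints (S : Finset (Edge d)) : Finset (Vertex d) :=
  S.biUnion fun e => e.1.toFinset

@[simp] lemma mem_endpoints {S : Finset (Edge d)} {x : Vertex d} :
    x ∈ endpoints S ↔ ∃ e ∈ S, x ∈ e.1 := by simp [endpoints]

open Classical in
/-- The vertices that count for the number of clusters: all endpoints for free boundary conditions,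
and those that only have edges in `S` for wired boundary conditions. -/
noncomputable def BoundaryType.region (b : BoundaryType) (S : Finset (Edge d)) :
    Finset (Vertex d) :=
  match b with
  | .free => endpoints S
  | .wired => (endpoints S).filter fun x => ∀ e : Edge d, x ∈ e.1 → e ∈ S

lemma BoundaryType.region_subset_endpoints (b : BoundaryType) (S : Finset (Edge d)) :
    b.region S ⊆ endpoints S := by
  cases b
  · exact subset_rfl
  · intro x hx
    simp only [BoundaryType.region, Finset.mem_filter] at hx
    exact hx.1

lemma region_wired_mono {S R : Finset (Edge d)} (h : S ⊆ R) :
    BoundaryType.wired.region S ⊆ BoundaryType.wired.region R := by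
  intro x hx
  simp only [BoundaryType.region, Finset.mem_filter, mem_endpoints] at hx ⊢
  obtain ⟨⟨e, he, hxe⟩, h2⟩ := hx
  exact ⟨⟨e, h he, hxe⟩, fun e he => h (h2 e he)⟩

/-- The random-cluster probability of `A` on the edge set `S`; configurations are extended by
`b.state` off `S`. -/
noncomputable def prob (b : BoundaryType) (p q : ℝ) (S : Finset (Edge d)) (A : Set (Config d)) : ℝ :=
  rcSum b.state S (fun _ => p) q (b.region S) A /
    rcSum b.state S (fun _ => p) q (b.region S) Set.univ

/-- The event that all edges of `F` are in state `s`. -/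
def agreeEvent (s : Bool) (F : Finset (Edge d)) : Set (Config d) := {ω | ∀ e ∈ F, ω e = s}

lemma isUpperSet_agreeEvent (F : Finset (Edge d)) : IsUpperSet (agreeEvent true F) :=
  fun _ _ h hω e he => Bool.le_iff_imp.1 (h e) (hω e he)

lemma isLowerSet_agreeEvent (F : Finset (Edge d)) : IsLowerSet (agreeEvent false F) := by
  intro ω ω' h hω e he
  have h1 := Bool.le_iff_imp.1 (h e)
  have h2 := hω e he
  cases h3 : ω' e
  · rfl
  · rw [h1 h3] at h2
    exact h2

lemma agreeEvent_union [DecidableEq (Edge d)] (s : Bool) (F F' : Finset (Edge d)) :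
    agreeEvent s (F ∪ F') = agreeEvent s F ∩ agreeEvent s F' := by
  ext ω
  simp only [agreeEvent, Finset.mem_union, Set.mem_ofPred_eq, Set.mem_inter_iff]
  exact ⟨fun h => ⟨fun e he => h e (Or.inl he), fun e he => h e (Or.inr he)⟩,
    fun h e he => he.elim (h.1 e) (h.2 e)⟩

/-! ### Comparison of domains, positive association and the cost of opening an edge -/

section Domain

variable {b : BoundaryType} {p q : ℝ} {S R : Finset (Edge d)}

open Classical in
/-- The parameters that force the state `s` off `S`. -/
noncomputable def forcedParam (s : Bool) (p : ℝ) (S : Finset (Edge d)) (e : Edge d) : ℝ :=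
  if e ∈ S then p else if s then 1 else 0

lemma forcedParam_mem (hp : p ∈ Set.Icc (0 : ℝ) 1) (s : Bool) (e : Edge d) :
    forcedParam s p S e ∈ Set.Icc (0 : ℝ) 1 := by
  unfold forcedParam
  split_ifs <;> simp [hp.1, hp.2]

lemma rcWeight_forced_eq_zero {s : Bool} {ω : Config d} {T : Finset (Vertex d)}
    (hω : ω ∈ configs s R) (hS : ω ∉ configs s S) : rcWeight R (forcedParam s p S) q T ω = 0 := by
  simp only [mem_configs, not_forall] at hω hS
  obtain ⟨e, he, hes⟩ := hS
  have heR : e ∈ R := by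
    by_contra h
    exact hes (hω e h)
  unfold rcWeight
  rw [Finset.prod_eq_zero heR, zero_mul]
  cases s <;> simp_all [edgeWeight, forcedParam]

lemma prod_edgeWeight_forced {s : Bool} (h : S ⊆ R) {ω : Config d} (hω : ω ∈ configs s S) :
    ∏ e ∈ R, edgeWeight (forcedParam s p S e) (ω e) = ∏ e ∈ S, edgeWeight p (ω e) := by
  rw [mem_configs] at hω
  rw [← Finset.prod_subset h]
  · exact Finset.prod_congr rfl fun e he => by simp [forcedParam, he]
  · intro e _ he
    cases s <;> simp [edgeWeight, forcedParam, he, hω e he]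

/-- Parameter 1 on `R \ S` kills every configuration with a closed edge there. The measure on `S`
thus lives on the configurations of `R`, where Holley's inequality can compare the two domains. -/
lemma rcSum_forced_wired (h : S ⊆ R) (T : Finset (Vertex d)) (A : Set (Config d)) :
    rcSum true R (forcedParam true p S) q T A = rcSum true S (fun _ => p) q T A := by
  rw [rcSum_eq_sum_indicator, rcSum_eq_sum_indicator, ← Finset.sum_subset (configs_mono true h)]
  · refine Finset.sum_congr rfl fun ω hω => ?_
    rw [Set.indicator, Set.indicator, rcWeight, rcWeight, prod_edgeWeight_forced h hω]
  · intro ω hω hω'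
    rw [Set.indicator_apply_eq_zero]
    exact fun _ => rcWeight_forced_eq_zero hω hω'

lemma not_adj_of_mem_configs_false {ω : Config d} (hω : ω ∈ configs false S) {x y : Vertex d}
    (hx : x ∉ endpoints S) : ¬ (openGraph ω).Adj x y := by
  rw [mem_configs] at hω
  intro hxy
  obtain ⟨h1, h2⟩ := openGraph_adj.1 hxy
  rw [hω _ fun h => hx (mem_endpoints.2 ⟨_, h, by simp⟩)] at h2
  simp at h2

/-- With all edges closed off `S`, the vertices that are no endpoint of `S` are isolated; they
contribute a constant. -/
lemma clusterRank_of_mem_configs_false [DecidableEq (Vertex d)] {ω : Config d}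
    (hω : ω ∈ configs false S)
    {T : Finset (Vertex d)} (hT : endpoints S ⊆ T) :
    clusterRank T ω = clusterRank (endpoints S) ω +
      clusterRank (T \ endpoints S) (fun _ => false : Config d) := by
  conv_lhs => rw [← Finset.union_sdiff_of_subset hT]
  rw [clusterRank_union Finset.disjoint_sdiff]
  · congr 1
    refine clusterRank_congr fun e x hx hxe => ?_
    rw [mem_configs] at hω
    exact hω e fun he => (Finset.mem_sdiff.1 hx).2 (mem_endpoints.2 ⟨e, he, hxe⟩)
  · intro x _ y hy hxy
    exact not_adj_of_mem_configs_false hω (Finset.mem_sdiff.1 hy).2 hxy.symm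

lemma rcSum_forced_free [DecidableEq (Vertex d)] (h : S ⊆ R) {T : Finset (Vertex d)}
    (hT : endpoints S ⊆ T) (A : Set (Config d)) :
    rcSum false R (forcedParam false p S) q T A =
      q ^ clusterRank (T \ endpoints S) (fun _ => false : Config d) *
        rcSum false S (fun _ => p) q (endpoints S) A := by
  rw [rcSum_eq_sum_indicator, rcSum_eq_sum_indicator, ← Finset.sum_subset (configs_mono false h),
    Finset.mul_sum]
  · refine Finset.sum_congr rfl fun ω hω => ?_
    simp only [Set.indicator, rcWeight, prod_edgeWeight_forced h hω,
      clusterRank_of_mem_configs_false hω hT, pow_add]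
    split_ifs <;> ring
  · intro ω hω hω'
    rw [Set.indicator_apply_eq_zero]
    exact fun _ => rcWeight_forced_eq_zero hω hω'

lemma endpoints_mono (h : S ⊆ R) : endpoints S ⊆ endpoints R := by
  intro x hx
  rw [mem_endpoints] at hx ⊢
  obtain ⟨e, he, hxe⟩ := hx
  exact ⟨e, h he, hxe⟩

variable (hp : p ∈ Set.Icc (0 : ℝ) 1) (hq : 1 ≤ q)

include hp hq in
lemma rcSum_const_univ_pos (S : Finset (Edge d)) :
    0 < rcSum b.state S (fun _ => p) q (b.region S) Set.univ :=
  rcSum_univ_pos (fun _ => hp) hq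

include hp hq in
lemma prob_nonneg (A : Set (Config d)) : 0 ≤ prob b p q S A :=
  div_nonneg (rcSum_nonneg (fun _ => hp) hq A) (rcSum_nonneg (fun _ => hp) hq _)

include hp hq in
lemma prob_univ : prob b p q S Set.univ = 1 := div_self (rcSum_const_univ_pos hp hq S).ne'

lemma prob_union {A B : Set (Config d)} (h : Disjoint A B) :
    prob b p q S (A ∪ B) = prob b p q S A + prob b p q S B := by
  rw [prob, prob, prob, ← add_div]
  congr 1
  simp only [rcSum_eq_sum_indicator, ← Finset.sum_add_distrib]
  refine Finset.sum_congr rfl fun ω _ => ?_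
  rw [Set.indicator_union_of_disjoint h]

include hp hq in
-- The measure on the small domain is the one on the large domain with the additional edges forced
-- into the boundary state. By Holley's inequality, forcing edges closed favours the decreasing
-- event, and forcing them open the increasing one.
lemma prob_agreeEvent_antitone (F : Finset (Edge d)) :
    Antitone fun S => prob b p q S (agreeEvent b.state F) := by
  classical
  intro S R h
  have hpos := rcSum_const_univ_pos (b := b) hp hq S
  have hpos' := rcSum_const_univ_pos (b := b) hp hq R
  dsimp only [prob]
  rw [div_le_div_iff₀ hpos' hpos]
  cases b with
  | free =>
    have key := rcSum_mul_le_of_isLowerSet (s := false) (S := R) (r := forcedParam false p S)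
      (r' := fun _ => p) (T := endpoints R) (T' := endpoints R)
      (fun e => forcedParam_mem hp _ e) (fun _ => hp)
      (fun e => by unfold forcedParam; split_ifs <;> simp_all [hp.1]) hq subset_rfl
      isLowerSet_univ (isLowerSet_agreeEvent F)
    rw [rcSum_forced_free h (endpoints_mono h), rcSum_forced_free h (endpoints_mono h),
      Set.univ_inter, mul_assoc, mul_assoc] at key
    -- The power of `q` coming from the isolated vertices appears on both sides and cancels.
    have := le_of_mul_le_mul_left key (by positivity)
    simp only [BoundaryType.state, BoundaryType.region] at this ⊢
    linarith
  | wired =>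
    have key := rcSum_mul_le_of_isUpperSet (s := true) (S := R) (r' := forcedParam true p S)
      (r := fun _ => p) (T := BoundaryType.wired.region R) (T' := BoundaryType.wired.region S)
      (fun _ => hp) (fun e => forcedParam_mem hp _ e)
      (fun e => by unfold forcedParam; split_ifs <;> simp_all [hp.2]) hq (region_wired_mono h)
      (isUpperSet_agreeEvent F) isUpperSet_univ
    rw [rcSum_forced_wired h, rcSum_forced_wired h, Set.inter_univ] at key
    simp only [BoundaryType.state] at key ⊢
    linarith

include hp hq in
lemma prob_mul_le_prob_inter (F F' : Finset (Edge d)) :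
    prob b p q S (agreeEvent b.state F) * prob b p q S (agreeEvent b.state F') ≤
      prob b p q S (agreeEvent b.state F ∩ agreeEvent b.state F') := by
  have hpos := rcSum_const_univ_pos (b := b) hp hq S
  unfold prob
  rw [div_mul_div_comm, div_le_div_iff₀ (by positivity) hpos, ← mul_assoc]
  refine mul_le_mul_of_nonneg_right ?_ hpos.le
  cases b with
  | free =>
    exact rcSum_mul_le_of_isLowerSet (fun _ => hp) (fun _ => hp) (fun _ => le_rfl) hq subset_rfl
      (isLowerSet_agreeEvent F) (isLowerSet_agreeEvent F')
  | wired =>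
    rw [mul_comm (rcSum _ _ _ _ _ (_ ∩ _))]
    exact rcSum_mul_le_of_isUpperSet (fun _ => hp) (fun _ => hp) (fun _ => le_rfl) hq subset_rfl
      (isUpperSet_agreeEvent F) (isUpperSet_agreeEvent F')

include hp hq in
/-- Opening an edge is not too costly. -/
lemma prob_preimage_update_le [DecidableEq (Edge d)] (hp0 : 0 < p) {e : Edge d} (he : e ∈ S)
    (A : Set (Config d)) :
    prob b p q S ((fun ω => Function.update ω e true) ⁻¹' A) ≤ (1 + q / p) * prob b p q S A := by
  unfold prob
  rw [← mul_div_assoc]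
  refine div_le_div_of_nonneg_right ?_ (rcSum_nonneg (fun _ => hp) hq _)
  set W := rcWeight S (fun _ => p) q (b.region S) with hW
  have hWn : ∀ ω, 0 ≤ W ω := rcWeight_nonneg (fun _ => hp) hq _
  -- The factor of `e` was at most 1 and becomes `p`; the rank drops by at most one, which costs at
  -- most a factor `q`.
  have hcost : ∀ ω, W ω ≤ q / p * W (Function.update ω e true) := by
    intro ω
    simp only [hW, rcWeight]
    rw [← Finset.mul_prod_erase _ _ he, ← Finset.mul_prod_erase _ _ he]
    have h1 : ∏ x ∈ S.erase e, edgeWeight p (Function.update ω e true x) =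
        ∏ x ∈ S.erase e, edgeWeight p (ω x) :=
      Finset.prod_congr rfl fun x hx => by rw [Function.update_of_ne (Finset.ne_of_mem_erase hx)]
    rw [h1, Function.update_self]
    have h2 : edgeWeight p (ω e) ≤ 1 := by
      unfold edgeWeight; split_ifs <;> linarith [hp.1, hp.2]
    have h3 : edgeWeight p true = p := by simp [edgeWeight]
    have h4 : 0 ≤ ∏ x ∈ S.erase e, edgeWeight p (ω x) :=
      Finset.prod_nonneg fun x _ => edgeWeight_nonneg hp _
    have h5 : q ^ clusterRank (b.region S) ω ≤
        q ^ clusterRank (b.region S) (Function.update ω e true) * q := by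
      rw [← pow_succ]
      exact pow_le_pow_right₀ hq (clusterRank_le_update _ _ _)
    rw [h3]
    calc edgeWeight p (ω e) * (∏ x ∈ S.erase e, edgeWeight p (ω x)) * q ^ clusterRank (b.region S) ω
        ≤ 1 * (∏ x ∈ S.erase e, edgeWeight p (ω x)) *
          (q ^ clusterRank (b.region S) (Function.update ω e true) * q) := by gcongr
      _ = _ := by field_simp
  rw [rcSum_eq_sum_indicator, rcSum_eq_sum_indicator, ← hW]
  set C := configs b.state S
  -- If `e` is already open the update changes nothing, which gives the term 1 of the constant; if
  -- `e` is closed the cost bound gives `q / p`.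
  have hle : ∀ ω, ((fun ω => Function.update ω e true) ⁻¹' A).indicator W ω ≤
      A.indicator W ω + if ω e = false then q / p * A.indicator W (Function.update ω e true) else 0 := by
    intro ω
    have n2 : 0 ≤ q / p := by have := hp.1; positivity
    cases h : ω e
    · have n1 : 0 ≤ A.indicator W ω := Set.indicator_nonneg (fun ω _ => hWn ω) _
      by_cases hA : Function.update ω e true ∈ A
      · rw [Set.indicator_of_mem (by exact hA), if_pos rfl, Set.indicator_of_mem hA]
        linarith [hcost ω]
      · rw [Set.indicator_of_notMem (by exact hA), if_pos rfl, Set.indicator_of_notMem hA]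
        linarith
    · have : Function.update ω e true = ω := by rw [← h, Function.update_eq_self]
      rw [if_neg (by simp), add_zero]
      by_cases hA : ω ∈ A
      · rw [Set.indicator_of_mem hA, Set.indicator_of_mem (by rwa [Set.mem_preimage, this])]
      · rw [Set.indicator_of_notMem hA, Set.indicator_of_notMem (by rwa [Set.mem_preimage, this])]
  refine (Finset.sum_le_sum fun ω _ => hle ω).trans ?_
  rw [Finset.sum_add_distrib, one_add_mul, ← Finset.sum_filter, ← Finset.mul_sum]
  gcongr
  classical
  -- Opening `e` is injective on the configurations in which `e` is closed.
  rw [← Finset.sum_image (f := fun ω => A.indicator W ω) (g := fun ω => Function.update ω e true)]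
  · refine Finset.sum_le_sum_of_subset_of_nonneg ?_
      fun ω _ _ => Set.indicator_nonneg (fun ω _ => hWn ω) _
    intro ω hω
    simp only [Finset.mem_image, Finset.mem_filter, C, mem_configs] at hω ⊢
    obtain ⟨ω', ⟨h1, -⟩, rfl⟩ := hω
    intro x hx
    rw [Function.update_of_ne (by rintro rfl; exact hx he), h1 x hx]
  · intro ω hω ω' hω' h
    simp only [Finset.coe_filter, Set.mem_ofPred_eq] at hω hω'
    ext x
    by_cases hx : x = e
    · rw [hx, hω.2, hω'.2]
    · have := congrFun h x
      simp only [Function.update_of_ne hx] at this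
      rw [this]

end Domain

/-! ### Invariance under automorphisms of the lattice -/

/-- The configuration `ω` seen through the automorphism `τ`. -/
def pull (τ : lattice d ≃g lattice d) (ω : Config d) : Config d := fun e => ω (τ.mapEdgeSet e)

/-- The image of a set of edges under an automorphism. -/
def moveEdges (τ : lattice d ≃g lattice d) (S : Finset (Edge d)) : Finset (Edge d) :=
  S.map τ.mapEdgeSet.toEmbedding

lemma mapEdgeSet_val (τ : lattice d ≃g lattice d) (e : Edge d) :
    (τ.mapEdgeSet e).1 = e.1.map τ := rfl

lemma mapEdgeSet_mem_moveEdges {τ : lattice d ≃g lattice d} {S : Finset (Edge d)} {e : Edge d} :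
    τ.mapEdgeSet e ∈ moveEdges τ S ↔ e ∈ S :=
  Finset.mem_map' τ.mapEdgeSet.toEmbedding

lemma forall_edge_iff (τ : lattice d ≃g lattice d) {P : Edge d → Prop} :
    (∀ e, P e) ↔ ∀ e, P (τ.mapEdgeSet e) := τ.mapEdgeSet.surjective.forall

lemma openGraph_pull_adj {τ : lattice d ≃g lattice d} {ω : Config d} {x y : Vertex d} :
    (openGraph (pull τ ω)).Adj x y ↔ (openGraph ω).Adj (τ x) (τ y) := by
  simp only [openGraph_adj, pull]
  constructor
  · rintro ⟨h, h'⟩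
    exact ⟨by simpa [τ.map_adj_iff] using h, h'⟩
  · rintro ⟨h, h'⟩
    exact ⟨by simpa [τ.map_adj_iff] using h, h'⟩

lemma pull_bijective (τ : lattice d ≃g lattice d) : Function.Bijective (pull (d := d) τ) := by
  constructor
  · intro ω ω' h
    ext e
    have := congrFun h (τ.mapEdgeSet.symm e)
    simp only [pull, Equiv.apply_symm_apply] at this
    rw [this]
  · intro ω
    exact ⟨fun e => ω (τ.mapEdgeSet.symm e), funext fun e => congrArg ω (τ.mapEdgeSet.symm_apply_apply e)⟩

lemma pull_mem_configs {τ : lattice d ≃g lattice d} {s : Bool} {S : Finset (Edge d)}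
    {ω : Config d} : pull τ ω ∈ configs s S ↔ ω ∈ configs s (moveEdges τ S) := by
  rw [mem_configs, mem_configs, forall_edge_iff τ (P := fun e => e ∉ moveEdges τ S → ω e = s)]
  simp only [mapEdgeSet_mem_moveEdges, pull]

lemma mem_mapEdgeSet {τ : lattice d ≃g lattice d} {x : Vertex d} {e : Edge d} :
    τ x ∈ (τ.mapEdgeSet e).1 ↔ x ∈ e.1 := by
  rw [mapEdgeSet_val, Sym2.mem_map]
  constructor
  · rintro ⟨y, hy, h⟩
    rwa [← τ.injective h]
  · exact fun h => ⟨x, h, rfl⟩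

lemma endpoints_moveEdges {τ : lattice d ≃g lattice d} {S : Finset (Edge d)} {x : Vertex d} :
    τ x ∈ endpoints (moveEdges τ S) ↔ x ∈ endpoints S := by
  rw [mem_endpoints, mem_endpoints, τ.mapEdgeSet.surjective.exists]
  simp only [mapEdgeSet_mem_moveEdges, mem_mapEdgeSet]

lemma region_moveEdges {τ : lattice d ≃g lattice d} {b : BoundaryType} {S : Finset (Edge d)}
    {x : Vertex d} : τ x ∈ b.region (moveEdges τ S) ↔ x ∈ b.region S := by
  cases b
  · exact endpoints_moveEdges
  · simp only [BoundaryType.region, Finset.mem_filter, endpoints_moveEdges]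
    rw [forall_edge_iff τ (P := fun e => τ x ∈ e.1 → e ∈ moveEdges τ S)]
    simp only [mapEdgeSet_mem_moveEdges, mem_mapEdgeSet]

lemma clusterRank_pull {τ : lattice d ≃g lattice d} {T T' : Finset (Vertex d)}
    (hT : ∀ x, τ x ∈ T' ↔ x ∈ T) (ω : Config d) :
    clusterRank T (pull τ ω) = clusterRank T' ω := by
  let L : (Vertex d → ℚ) ≃ₗ[ℚ] (Vertex d → ℚ) := LinearEquiv.funCongrLeft ℚ ℚ τ.toEquiv
  have : (clusterFunctions T' ω).map L.toLinearMap = clusterFunctions T (pull τ ω) := by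
    ext f
    rw [Submodule.mem_map_equiv]
    have hL : ∀ x, L.symm f (τ x) = f x := fun x => by
      change f (τ.symm (τ x)) = f x
      simp
    rw [mem_clusterFunctions, mem_clusterFunctions]
    rw [τ.surjective.forall, τ.surjective.forall₂]
    simp only [hT, hL, openGraph_pull_adj]
  unfold clusterRank
  rw [← this]
  exact (LinearEquiv.finrank_eq (L.submoduleMap _)).symm

lemma rcSum_moveEdges {τ : lattice d ≃g lattice d} {s : Bool} {S : Finset (Edge d)} {p q : ℝ}
    {b : BoundaryType} (A : Set (Config d)) :
    rcSum s (moveEdges τ S) (fun _ => p) q (b.region (moveEdges τ S)) (pull τ ⁻¹' A) =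
      rcSum s S (fun _ => p) q (b.region S) A := by
  rw [rcSum_eq_sum_indicator, rcSum_eq_sum_indicator]
  refine Finset.sum_bij (fun ω _ => pull τ ω) (fun ω hω => pull_mem_configs.2 hω)
    (fun ω _ ω' _ h => (pull_bijective τ).1 h) (fun ω hω => ?_) fun ω _ => ?_
  · obtain ⟨ω, rfl⟩ := (pull_bijective τ).2 ω
    exact ⟨ω, pull_mem_configs.1 hω, rfl⟩
  · have : rcWeight (moveEdges τ S) (fun _ => p) q (b.region (moveEdges τ S)) ω =
        rcWeight S (fun _ => p) q (b.region S) (pull τ ω) := by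
      unfold rcWeight
      rw [clusterRank_pull fun x => region_moveEdges, moveEdges, Finset.prod_map]
      rfl
    by_cases h : pull τ ω ∈ A
    · rw [Set.indicator_of_mem (by exact h), Set.indicator_of_mem h, this]
    · rw [Set.indicator_of_notMem (by exact h), Set.indicator_of_notMem h]

lemma prob_moveEdges (τ : lattice d ≃g lattice d) (b : BoundaryType) (p q : ℝ)
    (S : Finset (Edge d)) (A : Set (Config d)) :
    prob b p q (moveEdges τ S) (pull τ ⁻¹' A) = prob b p q S A := by
  unfold prob
  rw [rcSum_moveEdges, ← rcSum_moveEdges (τ := τ) (S := S) Set.univ, Set.preimage_univ]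

lemma pull_preimage_agreeEvent (τ : lattice d ≃g lattice d) (s : Bool) (F : Finset (Edge d)) :
    pull τ ⁻¹' agreeEvent s F = agreeEvent s (moveEdges τ F) := by
  ext ω
  simp only [agreeEvent, Set.mem_preimage, Set.mem_ofPred_eq]
  rw [forall_edge_iff τ (P := fun e => e ∈ moveEdges τ F → ω e = s)]
  simp only [mapEdgeSet_mem_moveEdges, pull]

/-! ### Independence on domains without common vertices -/

section Product

variable {S₁ S₂ : Finset (Edge d)}

lemma disjoint_of_disjoint_endpoints (h : Disjoint (endpoints S₁) (endpoints S₂)) :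
    Disjoint S₁ S₂ := by
  rw [Finset.disjoint_left] at h ⊢
  intro e h1 h2
  obtain ⟨e, he⟩ := e
  induction e with
  | h u v =>
    exact h (a := u) (mem_endpoints.2 ⟨_, h1, by simp⟩) (mem_endpoints.2 ⟨_, h2, by simp⟩)

variable [DecidableEq (Edge d)]

/-- The configuration that is equal to `ω` on `S` and to `s` off `S`. -/
def restrictTo (s : Bool) (S : Finset (Edge d)) (ω : Config d) : Config d :=
  fun e => if e ∈ S then ω e else s

lemma restrictTo_mem (s : Bool) (S : Finset (Edge d)) (ω : Config d) :
    restrictTo s S ω ∈ configs s S := by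
  rw [mem_configs]
  exact fun e he => by simp [restrictTo, he]

lemma region_union [DecidableEq (Vertex d)] (b : BoundaryType)
    (h : Disjoint (endpoints S₁) (endpoints S₂)) :
    b.region (S₁ ∪ S₂) = b.region S₁ ∪ b.region S₂ := by
  have hu : ∀ x, x ∈ endpoints (S₁ ∪ S₂) ↔ x ∈ endpoints S₁ ∨ x ∈ endpoints S₂ := by
    intro x
    simp only [mem_endpoints, Finset.mem_union, or_and_right, exists_or]
  ext x
  cases b with
  | free => simp only [BoundaryType.region, Finset.mem_union, hu]
  | wired =>
    simp only [BoundaryType.region, Finset.mem_union, hu, Finset.mem_filter]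
    constructor
    · rintro ⟨hx | hx, h2⟩
      · refine Or.inl ⟨hx, fun e he => (h2 e he).resolve_right fun h3 => ?_⟩
        exact Finset.disjoint_left.1 h hx (mem_endpoints.2 ⟨e, h3, he⟩)
      · refine Or.inr ⟨hx, fun e he => (h2 e he).resolve_left fun h3 => ?_⟩
        exact Finset.disjoint_left.1 h (mem_endpoints.2 ⟨e, h3, he⟩) hx
    · rintro (⟨hx, h2⟩ | ⟨hx, h2⟩)
      · exact ⟨Or.inl hx, fun e he => Or.inl (h2 e he)⟩
      · exact ⟨Or.inr hx, fun e he => Or.inr (h2 e he)⟩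

/-- Splitting the rank requires that no open edge joins the two regions. Such an edge would lie in
neither `S₁` nor `S₂`: for free boundary conditions it is then closed, and for wired ones every edge
at a vertex of the region belongs to the domain. -/
lemma clusterRank_region_union (b : BoundaryType)
    (h : Disjoint (endpoints S₁) (endpoints S₂)) {ω : Config d}
    (hω : ω ∈ configs b.state (S₁ ∪ S₂)) :
    clusterRank (b.region (S₁ ∪ S₂)) ω = clusterRank (b.region S₁) (restrictTo b.state S₁ ω) +
      clusterRank (b.region S₂) (restrictTo b.state S₂ ω) := by
  classical
  rw [mem_configs] at hω
  have agree : ∀ S S' : Finset (Edge d), Disjoint (endpoints S) (endpoints S') →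
      (∀ e ∉ S, e ∉ S' → ω e = b.state) →
      clusterRank (b.region S) (restrictTo b.state S ω) = clusterRank (b.region S) ω := by
    intro S S' hd hω
    refine clusterRank_congr fun e x hx hxe => ?_
    by_cases he : e ∈ S
    · simp [restrictTo, he]
    · have he' : e ∉ S' := fun h' => Finset.disjoint_left.1 hd
        (b.region_subset_endpoints S hx) (mem_endpoints.2 ⟨e, h', hxe⟩)
      simp [restrictTo, he, hω e he he']
  rw [region_union b h, clusterRank_union, agree S₁ S₂ h, agree S₂ S₁ h.symm]
  · exact fun e h1 h2 => hω e (by simp [h1, h2])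
  · exact fun e h1 h2 => hω e (by simp [h1, h2])
  · exact h.mono (b.region_subset_endpoints _) (b.region_subset_endpoints _)
  · intro x hx y hy hxy
    obtain ⟨h1, h2⟩ := openGraph_adj.1 hxy
    set e : Edge d := ⟨s(x, y), h1⟩ with he
    have hxe : x ∈ e.1 := by simp [he]
    have hye : y ∈ e.1 := by simp [he]
    have hx' := b.region_subset_endpoints _ hx
    have hy' := b.region_subset_endpoints _ hy
    have n1 : e ∉ S₁ := fun h' => Finset.disjoint_left.1 h (mem_endpoints.2 ⟨e, h', hye⟩) hy'
    have n2 : e ∉ S₂ := fun h' => Finset.disjoint_left.1 h hx' (mem_endpoints.2 ⟨e, h', hxe⟩)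
    cases b with
    | free =>
      rw [hω e (by simp [n1, n2])] at h2
      simp [BoundaryType.state] at h2
    | wired =>
      simp only [BoundaryType.region, Finset.mem_filter] at hx
      exact n1 (hx.2 e hxe)

/-- Configurations on the union are pairs of configurations, and both the edge product and the
cluster factor split. -/
lemma rcSum_union (b : BoundaryType) (p q : ℝ) (h : Disjoint (endpoints S₁) (endpoints S₂))
    (A₁ A₂ : Set (Config d)) :
    rcSum b.state (S₁ ∪ S₂) (fun _ => p) q (b.region (S₁ ∪ S₂))
        (restrictTo b.state S₁ ⁻¹' A₁ ∩ restrictTo b.state S₂ ⁻¹' A₂) =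
      rcSum b.state S₁ (fun _ => p) q (b.region S₁) A₁ *
        rcSum b.state S₂ (fun _ => p) q (b.region S₂) A₂ := by
  classical
  have hS := disjoint_of_disjoint_endpoints h
  simp only [rcSum_eq_sum_indicator]
  rw [Finset.sum_mul_sum, ← Finset.sum_product']
  refine Finset.sum_nbij' (fun ω => (restrictTo b.state S₁ ω, restrictTo b.state S₂ ω))
    (fun w e => if e ∈ S₁ then w.1 e else w.2 e) ?_ ?_ ?_ ?_ ?_
  · exact fun ω _ => Finset.mem_product.2 ⟨restrictTo_mem _ _ _, restrictTo_mem _ _ _⟩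
  · rintro ⟨ω₁, ω₂⟩ hω
    simp only [Finset.mem_product, mem_configs] at hω ⊢
    intro e he
    simp only [Finset.mem_union, not_or] at he
    simp [he.1, hω.2 e he.2]
  · intro ω hω
    rw [mem_configs] at hω
    ext e
    by_cases h1 : e ∈ S₁
    · simp [restrictTo, h1]
    · by_cases h2 : e ∈ S₂
      · simp [restrictTo, h1, h2]
      · simp [restrictTo, h1, h2, hω e (by simp [h1, h2])]
  · rintro ⟨ω₁, ω₂⟩ hω
    simp only [Finset.mem_product, mem_configs] at hω
    refine Prod.ext ?_ ?_
    · ext e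
      by_cases h1 : e ∈ S₁
      · simp [restrictTo, h1]
      · simp [restrictTo, h1, hω.1 e h1]
    · ext e
      by_cases h2 : e ∈ S₂
      · simp [restrictTo, h2, Finset.disjoint_right.1 hS h2]
      · simp [restrictTo, h2, hω.2 e h2]
  · intro ω hω
    have hW : rcWeight (S₁ ∪ S₂) (fun _ => p) q (b.region (S₁ ∪ S₂)) ω =
        rcWeight S₁ (fun _ => p) q (b.region S₁) (restrictTo b.state S₁ ω) *
          rcWeight S₂ (fun _ => p) q (b.region S₂) (restrictTo b.state S₂ ω) := by
      unfold rcWeight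
      rw [clusterRank_region_union b h hω, Finset.prod_union hS, pow_add, mul_mul_mul_comm]
      congr 2
      · exact Finset.prod_congr rfl fun e he => by simp [restrictTo, he]
      · exact Finset.prod_congr rfl fun e he => by simp [restrictTo, he]
    simp only [Set.indicator, Set.mem_inter_iff, Set.mem_preimage, hW]
    by_cases h1 : restrictTo b.state S₁ ω ∈ A₁ <;> by_cases h2 : restrictTo b.state S₂ ω ∈ A₂ <;>
      simp [h1, h2]

lemma restrictTo_preimage_agreeEvent {s : Bool} {S F : Finset (Edge d)} (h : F ⊆ S) :
    restrictTo s S ⁻¹' agreeEvent s F = agreeEvent s F := by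
  ext ω
  simp only [agreeEvent, Set.mem_preimage, Set.mem_ofPred_eq]
  exact forall₂_congr fun e he => by simp [restrictTo, h he]

lemma prob_union_agreeEvent (b : BoundaryType) (p q : ℝ)
    (h : Disjoint (endpoints S₁) (endpoints S₂)) {F₁ F₂ : Finset (Edge d)} (h₁ : F₁ ⊆ S₁)
    (h₂ : F₂ ⊆ S₂) :
    prob b p q (S₁ ∪ S₂) (agreeEvent b.state F₁ ∩ agreeEvent b.state F₂) =
      prob b p q S₁ (agreeEvent b.state F₁) * prob b p q S₂ (agreeEvent b.state F₂) := by
  unfold prob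
  rw [div_mul_div_comm, ← rcSum_union b p q h, ← rcSum_union b p q h,
    restrictTo_preimage_agreeEvent h₁, restrictTo_preimage_agreeEvent h₂]
  simp

end Product

/-! ### The finite-volume measures on boxes -/

lemma lattice_adj_add_single (x : Vertex d) (i : Fin d) :
    (lattice d).Adj x (x + Pi.single i 1) := by
  change ∑ j, (x j - (x + Pi.single i 1 : Vertex d) j) ^ 2 = 1
  rw [Finset.sum_eq_single i] <;> simp +contextual

lemma box_adj {n : ℕ} {x y : Vertex d} :
    (box d n).Adj x y ↔ x ∈ (box d n).verts ∧ y ∈ (box d n).verts ∧ (lattice d).Adj x y := by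
  simp [box]

/-- The vertices of the box `Λ_n`. -/
noncomputable def boxVerts (d n : ℕ) : Finset (Vertex d) :=
  Finset.Icc (fun _ => -(n : ℤ)) fun _ => (n : ℤ)

lemma mem_boxVerts {n : ℕ} {x : Vertex d} :
    x ∈ boxVerts d n ↔ ∀ i, -(n : ℤ) ≤ x i ∧ x i ≤ n := by
  simp [boxVerts, Pi.le_def, forall_and]

lemma mem_box_verts {n : ℕ} {x : Vertex d} : x ∈ (box d n).verts ↔ x ∈ boxVerts d n := by
  rw [mem_boxVerts]
  rfl

lemma mem_verts_of_mem_edgeSet {G : (lattice d).Subgraph} {e : Sym2 (Vertex d)}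
    (he : e ∈ G.edgeSet) {x : Vertex d} (hx : x ∈ e) : x ∈ G.verts :=
  G.mem_verts_of_mem_edge he hx

lemma finite_boxEdges (d n : ℕ) : {e : Edge d | e.1 ∈ (box d n).edgeSet}.Finite := by
  refine Set.Finite.of_injOn (f := Subtype.val) (t := {e : Sym2 (Vertex d) | ∀ x ∈ e, x ∈ boxVerts d n})
    (fun e he x hx => mem_box_verts.1 (mem_verts_of_mem_edgeSet he hx))
    Subtype.val_injective.injOn ?_
  have : {e : Sym2 (Vertex d) | ∀ x ∈ e, x ∈ boxVerts d n} = (boxVerts d n).sym2 := by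
    ext e
    exact Finset.mem_sym2_iff.symm
  rw [this]
  exact Finset.finite_toSet _

/-- The edges of the box `Λ_n`. -/
noncomputable def boxEdges (d n : ℕ) : Finset (Edge d) := (finite_boxEdges d n).toFinset

@[simp] lemma mem_boxEdges {n : ℕ} {e : Edge d} : e ∈ boxEdges d n ↔ e.1 ∈ (box d n).edgeSet := by
  simp [boxEdges]

lemma mem_boxEdges_mk {n : ℕ} {x y : Vertex d} {h : s(x, y) ∈ (lattice d).edgeSet} :
    (⟨s(x, y), h⟩ : Edge d) ∈ boxEdges d n ↔ x ∈ boxVerts d n ∧ y ∈ boxVerts d n := by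
  rw [mem_boxEdges, SimpleGraph.Subgraph.mem_edgeSet, box_adj, mem_box_verts, mem_box_verts]
  simp only [SimpleGraph.mem_edgeSet] at h
  simp [h]

lemma endpoints_boxEdges_subset (n : ℕ) : endpoints (boxEdges d n) ⊆ boxVerts d n := by
  intro x hx
  obtain ⟨e, he, hxe⟩ := mem_endpoints.1 hx
  exact mem_box_verts.1 (mem_verts_of_mem_edgeSet (mem_boxEdges.1 he) hxe)

lemma mem_boundary_box_iff (hd : 1 ≤ d) {n : ℕ} {x : Vertex d} (hx : x ∈ (box d n).verts) :
    x ∈ boundary (box d n) ↔ x ∉ BoundaryType.wired.region (boxEdges d n) := by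
  simp only [boundary, Set.mem_ofPred_eq, hx, true_and, BoundaryType.region, Finset.mem_filter,
    not_and, not_forall]
  constructor
  · rintro ⟨y, hxy, hn⟩ -
    exact ⟨⟨s(x, y), hxy⟩, by simp, by simpa using hn⟩
  · intro h
    by_cases hx' : x ∈ endpoints (boxEdges d n)
    · obtain ⟨⟨e, he⟩, hxe, hn⟩ := h hx'
      obtain ⟨y, rfl⟩ := Sym2.mem_iff_exists.1 hxe
      exact ⟨y, he, by simpa using hn⟩
    -- A vertex without an edge in the box, such as the origin when `n = 0`, is on the boundary
    -- because `d ≥ 1` provides a lattice edge at it.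
    · refine ⟨_, lattice_adj_add_single x ⟨0, hd⟩, fun hG => hx' (mem_endpoints.2 ?_)⟩
      exact ⟨⟨s(x, _), lattice_adj_add_single x ⟨0, hd⟩⟩, mem_boxEdges.2 hG, by simp⟩

lemma exists_mem_boundary_box (hd : 1 ≤ d) (n : ℕ) : ∃ x, x ∈ boundary (box d n) := by
  refine ⟨fun _ => n, mem_box_verts.2 (mem_boxVerts.2 fun i => by simp), _,
    lattice_adj_add_single _ ⟨0, hd⟩, fun h => ?_⟩
  have := (mem_boxVerts.1 (mem_box_verts.1 (box_adj.1 h).2.1) ⟨0, hd⟩).2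
  simp at this

open Classical in
/-- A configuration on `G`, extended by `s` off `G`. -/
noncomputable def extendBy (s : Bool) (G : (lattice d).Subgraph) (ω : G.edgeSet → Bool) : Config d :=
  fun e => if h : e.1 ∈ G.edgeSet then ω ⟨e.1, h⟩ else s

lemma extendBy_mem_configs {s : Bool} {n : ℕ} (ω : (box d n).edgeSet → Bool) :
    extendBy s (box d n) ω ∈ configs s (boxEdges d n) := by
  rw [mem_configs]
  intro e he
  rw [mem_boxEdges] at he
  simp [extendBy, he]

lemma openGraph_extendBy_adj {s : Bool} {G : (lattice d).Subgraph} {ω : G.edgeSet → Bool}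
    {x y : Vertex d} (h : s(x, y) ∈ G.edgeSet) :
    (openGraph (extendBy s G ω)).Adj x y ↔ ω ⟨s(x, y), h⟩ = true := by
  rw [openGraph_adj]
  have h' : s(x, y) ∈ (lattice d).edgeSet := G.edgeSet_subset h
  simp [extendBy, h, h']

lemma gluedGraph_adj {G : (lattice d).Subgraph} {ξ : Setoid (boundary G)} {ω : G.edgeSet → Bool}
    {x y : G.verts} :
    (gluedGraph G ξ ω).Adj x y ↔ x ≠ y ∧ ((∃ h : s(x.1, y.1) ∈ G.edgeSet, ω ⟨_, h⟩ = true) ∨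
      ∃ (hx : x.1 ∈ boundary G) (hy : y.1 ∈ boundary G), ξ ⟨x.1, hx⟩ ⟨y.1, hy⟩) := by
  unfold gluedGraph
  rw [SimpleGraph.fromRel_adj]
  refine and_congr_right fun _ => ⟨?_, Or.inl⟩
  rintro (h | ⟨h, h'⟩ | ⟨hx, hy, h⟩)
  · exact h
  · have e : s(y.1, x.1) = s(x.1, y.1) := Sym2.eq_swap
    exact Or.inl ⟨e ▸ h, by simpa only [e] using h'⟩
  · exact Or.inr ⟨hy, hx, ξ.symm h⟩

/-- Blocks that are singletons glue nothing. The second term accounts for the vertices of the box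
without an edge in the box, and does not depend on `ω`. -/
lemma numClusters_free [DecidableEq (Vertex d)] (n : ℕ) (ω : (box d n).edgeSet → Bool) :
    numClusters (box d n) (BoundaryType.free.toSetoid (box d n)) ω =
      clusterRank (BoundaryType.free.region (boxEdges d n)) (extendBy false (box d n) ω) +
      clusterRank (boxVerts d n \ endpoints (boxEdges d n)) (fun _ => false : Config d) := by
  have hmem := extendBy_mem_configs (s := false) ω
  change _ = clusterRank (endpoints (boxEdges d n)) _ + _
  rw [← clusterRank_of_mem_configs_false hmem (endpoints_boxEdges_subset n)]
  refine card_connectedComponent_eq_finrank (fun x => mem_box_verts) _ _ fun f => ?_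
  rw [mem_clusterFunctions]
  refine and_congr_right fun _ => ⟨fun h x y hxy => ?_, fun h x y hxy => ?_⟩
  · obtain ⟨hne, ⟨h1, h2⟩ | ⟨hx, hy, h1⟩⟩ := gluedGraph_adj.1 hxy
    · exact h _ _ ((openGraph_extendBy_adj h1).2 h2)
    · have h2 : (⟨x.1, hx⟩ : boundary (box d n)) = ⟨y.1, hy⟩ := h1
      exact absurd (Subtype.ext (Subtype.mk.inj h2)) hne
  · by_cases h1 : s(x, y) ∈ (box d n).edgeSet
    · have hx := mem_verts_of_mem_edgeSet h1 (x := x) (by simp)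
      have hy := mem_verts_of_mem_edgeSet h1 (x := y) (by simp)
      refine h ⟨x, hx⟩ ⟨y, hy⟩ (gluedGraph_adj.2 ⟨?_, Or.inl ⟨h1, (openGraph_extendBy_adj h1).1 hxy⟩⟩)
      simpa using hxy.ne
    · obtain ⟨h2, h3⟩ := openGraph_adj.1 hxy
      rw [mem_configs] at hmem
      rw [hmem _ (by simpa using h1)] at h3
      simp at h3

/-- On functions constant on the clusters of the glued graph, evaluation at a boundary vertex `z` is
a surjective linear form. Its kernel consists of the functions that vanish on the whole boundary,
which is the space behind the rank; the extra 1 is the boundary cluster. -/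
lemma numClusters_wired (hd : 1 ≤ d) (n : ℕ) (ω : (box d n).edgeSet → Bool) :
    numClusters (box d n) (BoundaryType.wired.toSetoid (box d n)) ω =
      clusterRank (BoundaryType.wired.region (boxEdges d n)) (extendBy true (box d n) ω) + 1 := by
  obtain ⟨z, hz⟩ := exists_mem_boundary_box hd n
  set H := gluedGraph (box d n) (BoundaryType.wired.toSetoid (box d n)) ω with hH
  have hadj : ∀ x y, H.Adj x y ↔ x ≠ y ∧ ((∃ h : s(x.1, y.1) ∈ (box d n).edgeSet,
      ω ⟨_, h⟩ = true) ∨ (x.1 ∈ boundary (box d n) ∧ y.1 ∈ boundary (box d n))) := by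
    intro x y
    rw [hH, gluedGraph_adj]
    refine and_congr_right fun _ => or_congr_right ⟨fun ⟨hx, hy, _⟩ => ⟨hx, hy⟩,
      fun ⟨hx, hy⟩ => ⟨hx, hy, trivial⟩⟩
  set T := BoundaryType.wired.region (boxEdges d n) with hT
  have hTV : T ⊆ boxVerts d n :=
    (BoundaryType.region_subset_endpoints _ _).trans (endpoints_boxEdges_subset n)
  let X : Submodule ℚ (Vertex d → ℚ) :=
    { carrier := {f | (∀ x ∉ boxVerts d n, f x = 0) ∧
        ∀ x y : (box d n).verts, H.Adj x y → f x = f y}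
      add_mem' := fun {f g} hf hg => ⟨fun x hx => by simp [hf.1 x hx, hg.1 x hx],
        fun x y h => by simp [hf.2 x y h, hg.2 x y h]⟩
      zero_mem' := ⟨fun _ _ => rfl, fun _ _ _ => rfl⟩
      smul_mem' := fun c f hf => ⟨fun x hx => by simp [hf.1 x hx],
        fun x y h => by simp [hf.2 x y h]⟩ }
  have : Module.Finite ℚ X := finite_of_support (boxVerts d n) X fun f hf => hf.1
  have hcard : numClusters (box d n) (BoundaryType.wired.toSetoid (box d n)) ω =
      Module.finrank ℚ X :=
    card_connectedComponent_eq_finrank (fun x => mem_box_verts) _ _ fun f => Iff.rfl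
  let φ : X →ₗ[ℚ] ℚ := (LinearMap.proj z : (Vertex d → ℚ) →ₗ[ℚ] ℚ).comp X.subtype
  have hrange : LinearMap.range φ = ⊤ := by
    refine LinearMap.range_eq_top.2 fun c => ?_
    refine ⟨⟨fun x => if x ∈ boxVerts d n then c else 0, fun x hx => by simp [hx],
      fun x y _ => ?_⟩, ?_⟩
    · simp [mem_box_verts.1 x.2, mem_box_verts.1 y.2]
    · change (if z ∈ boxVerts d n then c else 0) = c
      rw [if_pos (mem_box_verts.1 hz.1)]
  have hker : (LinearMap.ker φ).map X.subtype = clusterFunctions T (extendBy true (box d n) ω) := by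
    ext f
    rw [mem_clusterFunctions]
    constructor
    · rintro ⟨⟨f, hf⟩, hfz, rfl⟩
      have hfz : f z = 0 := hfz
      have h0 : ∀ x ∉ T, f x = 0 := by
        intro x hx
        by_cases hxV : x ∈ boxVerts d n
        · have hxb := (mem_boundary_box_iff hd (mem_box_verts.2 hxV)).2 hx
          by_cases hxz : x = z
          · rw [hxz, hfz]
          · rw [← hfz]
            exact hf.2 ⟨x, hxb.1⟩ ⟨z, hz.1⟩ ((hadj _ _).2 ⟨by simpa using hxz, Or.inr ⟨hxb, hz⟩⟩)
        · exact hf.1 x hxV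
      refine ⟨h0, fun x y hxy => ?_⟩
      by_cases h1 : s(x, y) ∈ (box d n).edgeSet
      · have hx := mem_verts_of_mem_edgeSet h1 (x := x) (by simp)
        have hy := mem_verts_of_mem_edgeSet h1 (x := y) (by simp)
        refine hf.2 ⟨x, hx⟩ ⟨y, hy⟩
          ((hadj _ _).2 ⟨?_, Or.inl ⟨h1, (openGraph_extendBy_adj h1).1 hxy⟩⟩)
        simpa using hxy.ne
      · obtain ⟨h2, h3⟩ := openGraph_adj.1 hxy
        have hn : ∀ w ∈ s(x, y), w ∉ T := fun w hw hwT => by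
          simp only [hT, BoundaryType.region, Finset.mem_filter] at hwT
          exact h1 (mem_boxEdges.1 (hwT.2 ⟨_, h2⟩ hw))
        change f x = f y
        rw [h0 x (hn x (by simp)), h0 y (hn y (by simp))]
    · rintro ⟨h0, h1⟩
      refine ⟨⟨f, fun x hx => h0 x fun h => hx (hTV h), fun x y hxy => ?_⟩, ?_, rfl⟩
      · obtain ⟨-, ⟨h2, h3⟩ | ⟨hx, hy⟩⟩ := (hadj x y).1 hxy
        · exact h1 _ _ ((openGraph_extendBy_adj h2).2 h3)
        · rw [h0 _ ((mem_boundary_box_iff hd x.2).1 hx), h0 _ ((mem_boundary_box_iff hd y.2).1 hy)]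
      · exact h0 _ ((mem_boundary_box_iff hd hz.1).1 hz)
  have h1 := φ.finrank_range_add_finrank_ker
  rw [hrange, finrank_top, Module.finrank_self, ← Submodule.finrank_map_subtype_eq, hker] at h1
  rw [hcard, ← h1, clusterRank, add_comm]

/-- The constant `c` only multiplies all weights by `q ^ c`, which disappears on normalising. -/
lemma exists_numClusters_eq (hd : 1 ≤ d) (b : BoundaryType) (n : ℕ) : ∃ c : ℕ,
    ∀ ω : (box d n).edgeSet → Bool, numClusters (box d n) (b.toSetoid (box d n)) ω =
      clusterRank (b.region (boxEdges d n)) (extendBy b.state (box d n) ω) + c := by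
  classical
  cases b
  · exact ⟨_, numClusters_free n⟩
  · exact ⟨1, numClusters_wired hd n⟩

instance (d n : ℕ) : Finite (box d n).edgeSet := by
  refine Finite.of_injective (β := boxEdges d n)
    (fun e => ⟨⟨e.1, (box d n).edgeSet_subset e.2⟩, mem_boxEdges.2 e.2⟩) fun e e' h => ?_
  simpa [Subtype.ext_iff] using h

lemma prod_boxEdges (p : ℝ) (s : Bool) (n : ℕ) (ω : (box d n).edgeSet → Bool) :
    ∏ e ∈ boxEdges d n, edgeWeight p (extendBy s (box d n) ω e) =
      p ^ Nat.card {e // ω e = true} * (1 - p) ^ Nat.card {e // ω e = false} := by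
  classical
  have : Fintype (box d n).edgeSet := Fintype.ofFinite _
  have h1 : ∏ e ∈ boxEdges d n, edgeWeight p (extendBy s (box d n) ω e) =
      ∏ a : (box d n).edgeSet, edgeWeight p (ω a) := by
    refine Finset.prod_bij' (fun e he => ⟨e.1, mem_boxEdges.1 he⟩)
      (fun a _ => ⟨a.1, (box d n).edgeSet_subset a.2⟩) ?_ ?_ ?_ ?_ ?_
    · simp
    · exact fun a _ => mem_boxEdges.2 a.2
    · simp
    · simp
    · intro e he
      rw [mem_boxEdges] at he
      simp [extendBy, he]
  rw [h1]
  simp only [edgeWeight]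
  rw [Finset.prod_ite, Finset.prod_const, Finset.prod_const, Nat.card_eq_fintype_card,
    Nat.card_eq_fintype_card, Fintype.card_subtype, Fintype.card_subtype]
  simp

lemma finiteMeasure_box (hd : 1 ≤ d) (b : BoundaryType) {p q : ℝ} (hp : p ∈ Set.Icc (0 : ℝ) 1)
    (hq : 1 ≤ q) {n : ℕ} {F : Finset (Edge d)} (hF : F ⊆ boxEdges d n) {A : Set (Config d)}
    (hA : ∀ ω ω' : Config d, (∀ e ∈ F, ω e = ω' e) → (ω ∈ A ↔ ω' ∈ A)) :
    finiteMeasure (box d n) (b.toSetoid (box d n)) p q (extend (box d n) ⁻¹' A) =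
      ENNReal.ofReal (prob b p q (boxEdges d n) A) := by
  classical
  have : Fintype (box d n).edgeSet := Fintype.ofFinite _
  obtain ⟨c, hc⟩ := exists_numClusters_eq hd b n
  set W := rcWeight (boxEdges d n) (fun _ => p) q (b.region (boxEdges d n)) with hWdef
  have hW : ∀ ω, weight (box d n) (b.toSetoid (box d n)) p q ω =
      q ^ c * W (extendBy b.state (box d n) ω) := by
    intro ω
    rw [weight, hc ω, hWdef, rcWeight, prod_boxEdges, pow_add]
    ring
  have hsum : ∀ B : Set (Config d), ∑ ω : (box d n).edgeSet → Bool,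
      B.indicator (fun ω => W ω) (extendBy b.state (box d n) ω) =
      rcSum b.state (boxEdges d n) (fun _ => p) q (b.region (boxEdges d n)) B := by
    intro B
    rw [rcSum_eq_sum_indicator]
    refine Finset.sum_bij' (fun ω _ => extendBy b.state (box d n) ω)
      (fun ω _ a => ω ⟨a.1, (box d n).edgeSet_subset a.2⟩) ?_ ?_ ?_ ?_ ?_
    · exact fun ω _ => extendBy_mem_configs ω
    · simp
    · intro ω _
      ext a
      simp [extendBy]
    · intro ω hω
      rw [mem_configs] at hω
      funext e
      by_cases he : e.1 ∈ (box d n).edgeSet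
      · simp [extendBy, he]
      · simp [extendBy, he, hω e (by simpa using he)]
    · exact fun ω _ => rfl
  have hAe : ∀ ω, extend (box d n) ω ∈ A ↔ extendBy b.state (box d n) ω ∈ A := by
    intro ω
    refine hA _ _ fun e he => ?_
    have := mem_boxEdges.1 (hF he)
    simp [extend, extendBy, this]
  have hZ : partitionFunction (box d n) (b.toSetoid (box d n)) p q =
      q ^ c * rcSum b.state (boxEdges d n) (fun _ => p) q (b.region (boxEdges d n)) Set.univ := by
    rw [partitionFunction, tsum_fintype, ← hsum, Finset.mul_sum]
    exact Finset.sum_congr rfl fun ω _ => by rw [hW, Set.indicator_univ]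
  have hZpos := rcSum_const_univ_pos (b := b) hp hq (boxEdges d n)
  have hqc : 0 < q ^ c := by positivity
  have hWn : ∀ ω, 0 ≤ W ω := rcWeight_nonneg (fun _ => hp) hq _
  rw [finiteMeasure, Measure.sum_apply _ (Set.toFinite _).measurableSet, tsum_fintype, prob, ← hsum A,
    Finset.sum_div, ENNReal.ofReal_sum_of_nonneg]
  · refine Finset.sum_congr rfl fun ω _ => ?_
    rw [Measure.smul_apply, Measure.dirac_apply' _ (Set.toFinite _).measurableSet, smul_eq_mul,
      hW, hZ, mul_div_mul_left _ _ hqc.ne']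
    by_cases h : extend (box d n) ω ∈ A
    · rw [Set.indicator_of_mem (by exact h), Set.indicator_of_mem ((hAe ω).1 h), Pi.one_apply,
        mul_one]
    · rw [Set.indicator_of_notMem (by exact h), Set.indicator_of_notMem (mt (hAe ω).2 h), mul_zero,
        zero_div, ENNReal.ofReal_zero]
  · exact fun ω _ => div_nonneg (Set.indicator_nonneg (fun ω _ => hWn ω) _) hZpos.le

/-! ### Cylinder events -/

lemma DependsOnFinitelyManyEdges.mem_measurableCylinders {A : Set (Config d)}
    (hA : DependsOnFinitelyManyEdges A) : A ∈ measurableCylinders fun _ : Edge d => Bool := by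
  obtain ⟨F, hF⟩ := hA
  rw [MeasureTheory.mem_measurableCylinders]
  refine ⟨F, F.restrict '' A, (Set.toFinite _).measurableSet, ?_⟩
  ext ω
  rw [mem_cylinder]
  constructor
  · exact fun h => ⟨ω, h, rfl⟩
  · rintro ⟨ω', h, h'⟩
    exact (hF ω' ω fun e he => congrFun h' ⟨e, he⟩).1 h

lemma dependsOnFinitelyManyEdges_iff {A : Set (Config d)} :
    DependsOnFinitelyManyEdges A ↔ A ∈ measurableCylinders fun _ : Edge d => Bool := by
  refine ⟨fun h => h.mem_measurableCylinders, fun h => ?_⟩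
  rw [MeasureTheory.mem_measurableCylinders] at h
  obtain ⟨F, S, -, rfl⟩ := h
  refine ⟨F, fun ω ω' h => ?_⟩
  rw [mem_cylinder, mem_cylinder]
  have : F.restrict ω = F.restrict ω' := funext fun e => h e.1 e.2
  rw [this]

lemma DependsOnFinitelyManyEdges.measurableSet {A : Set (Config d)}
    (hA : DependsOnFinitelyManyEdges A) : MeasurableSet A :=
  .of_mem_measurableCylinders hA.mem_measurableCylinders

lemma isClopen_of_mem_measurableCylinders {A : Set (Config d)}
    (hA : A ∈ measurableCylinders fun _ : Edge d => Bool) : IsClopen A := by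
  rw [MeasureTheory.mem_measurableCylinders] at hA
  obtain ⟨F, S, -, rfl⟩ := hA
  exact (isClopen_discrete S).preimage (Finset.continuous_restrict F)

lemma dependsOnFinitelyManyEdges_agreeEvent (s : Bool) (F : Finset (Edge d)) :
    DependsOnFinitelyManyEdges (agreeEvent s F) :=
  ⟨F, fun _ _ h => forall₂_congr fun e he => by rw [h e he]⟩

lemma isPiSystem_agreeEvent (s : Bool) : IsPiSystem (Set.range (agreeEvent (d := d) s)) := by
  classical
  rintro _ ⟨F, rfl⟩ _ ⟨F', rfl⟩ -
  exact ⟨F ∪ F', agreeEvent_union s F F'⟩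

lemma generateFrom_agreeEvent (s : Bool) :
    (MeasurableSpace.pi : MeasurableSpace (Config d)) =
      MeasurableSpace.generateFrom (Set.range (agreeEvent s)) := by
  apply le_antisymm
  · have : @Measurable (Config d) (Config d)
        (MeasurableSpace.generateFrom (Set.range (agreeEvent s))) MeasurableSpace.pi id := by
      refine @measurable_pi_lambda _ _ _ (MeasurableSpace.generateFrom _) _ _ fun e => ?_
      have h : MeasurableSet[MeasurableSpace.generateFrom (Set.range (agreeEvent s))]
          {ω : Config d | ω e = s} :=
        MeasurableSpace.measurableSet_generateFrom ⟨{e}, by ext; simp [agreeEvent]⟩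
      refine @measurable_to_bool _ (MeasurableSpace.generateFrom _) _ ?_
      cases s
      · convert h.compl using 1
        ext ω
        simp
      · exact h
    exact fun A hA => this hA
  · refine MeasurableSpace.generateFrom_le ?_
    rintro _ ⟨F, rfl⟩
    exact (dependsOnFinitelyManyEdges_agreeEvent s F).measurableSet

/-- Measures need only be compared on the events for which monotonicity and FKG are available,
because these form a generating π-system. -/
lemma ext_of_agreeEvent (s : Bool) {μ ν : Measure (Config d)} [IsFiniteMeasure μ]
    (h : ∀ F, μ (agreeEvent s F) = ν (agreeEvent s F)) : μ = ν := by
  refine ext_of_generate_finite _ (generateFrom_agreeEvent s) (isPiSystem_agreeEvent s) ?_ ?_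
  · rintro _ ⟨F, rfl⟩
    exact h F
  · have : agreeEvent s (∅ : Finset (Edge d)) = Set.univ := by ext; simp [agreeEvent]
    rw [← this, h]

/-! ### Convergence of the finite-volume probabilities of cylinder events -/

section Limit

variable {b : BoundaryType} {p q : ℝ} (hp : p ∈ Set.Icc (0 : ℝ) 1) (hq : 1 ≤ q)

include hp hq in
-- The limit is along the directed set of all finite edge sets, not only along boxes; invariance
-- under automorphisms follows from this.
lemma exists_tendsto_prob_agreeEvent (F : Finset (Edge d)) :
    ∃ L, Tendsto (fun S => prob b p q S (agreeEvent b.state F)) atTop (𝓝 L) :=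
  ⟨_, tendsto_atTop_ciInf (prob_agreeEvent_antitone hp hq F)
    ⟨0, by rintro _ ⟨S, rfl⟩; exact prob_nonneg hp hq _⟩⟩

include hp hq in
lemma exists_tendsto_prob_inter [DecidableEq (Edge d)] (F₁ F₂ : Finset (Edge d)) :
    ∃ L, Tendsto (fun S => prob b p q S (agreeEvent b.state F₁ ∩ agreeEvent (!b.state) F₂)) atTop
      (𝓝 L) := by
  induction F₂ using Finset.induction generalizing F₁ with
  | empty =>
    have : agreeEvent (!b.state) (∅ : Finset (Edge d)) = Set.univ := by ext; simp [agreeEvent]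
    simp only [this, Set.inter_univ]
    exact exists_tendsto_prob_agreeEvent hp hq F₁
  | insert e F he ih =>
    obtain ⟨L, hL⟩ := ih F₁
    obtain ⟨L', hL'⟩ := ih (insert e F₁)
    -- Inclusion-exclusion on one edge: the event with `e` in the opposite state is the one with `e`
    -- unconstrained minus the one with `e` in the boundary state.
    refine ⟨L - L', (hL.sub hL').congr fun S => ?_⟩
    rw [sub_eq_iff_eq_add, ← prob_union]
    · congr 1
      ext ω
      simp only [agreeEvent, Set.mem_inter_iff, Set.mem_ofPred_eq, Finset.mem_insert,
        forall_eq_or_imp, Set.mem_union]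
      cases hω : ω e <;> cases b.state <;> simp
    · rw [Set.disjoint_left]
      intro ω h1 h2
      have h3 : ω e = !b.state := h1.2 e (Finset.mem_insert_self e F)
      rw [h2.1 e (Finset.mem_insert_self e F₁)] at h3
      cases b.state <;> simp at h3

include hp hq in
-- Splitting on the state of one edge at a time, and replacing `A` by its preimage under fixing that
-- edge, removes the dependence of `A` on the edge. The sets `F₁` and `F₂` record the states already
-- fixed; at the end `A` is trivial.
lemma exists_tendsto_prob {A : Set (Config d)} (hA : DependsOnFinitelyManyEdges A) :
    ∃ L, Tendsto (fun S => prob b p q S A) atTop (𝓝 L) := by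
  classical
  obtain ⟨F, hF⟩ := hA
  suffices h : ∀ F₁ F₂, ∃ L, Tendsto (fun S => prob b p q S
      (A ∩ (agreeEvent b.state F₁ ∩ agreeEvent (!b.state) F₂))) atTop (𝓝 L) by
    have : ∀ s, agreeEvent s (∅ : Finset (Edge d)) = Set.univ := by intro s; ext; simp [agreeEvent]
    simpa [this] using h ∅ ∅
  induction F using Finset.induction generalizing A with
  | empty =>
    intro F₁ F₂
    by_cases hne : A.Nonempty
    · obtain ⟨ω₀, h₀⟩ := hne
      have : A = Set.univ := Set.eq_univ_of_forall fun ω => (hF ω₀ ω (by simp)).1 h₀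
      simp only [this, Set.univ_inter]
      exact exists_tendsto_prob_inter hp hq F₁ F₂
    · rw [Set.not_nonempty_iff_eq_empty] at hne
      refine ⟨0, tendsto_const_nhds.congr fun S => ?_⟩
      simp [hne, prob, rcSum]
  | insert e F he ih =>
    intro F₁ F₂
    have hdep : ∀ x, ∀ ω ω' : Config d, (∀ e ∈ F, ω e = ω' e) →
        (ω ∈ (fun ω => Function.update ω e x) ⁻¹' A ↔
          ω' ∈ (fun ω => Function.update ω e x) ⁻¹' A) := by
      intro x ω ω' h
      refine hF _ _ fun e' he' => ?_
      by_cases hee : e' = e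
      · subst hee; simp
      · simp [Function.update_of_ne hee, h e' ((Finset.mem_insert.1 he').resolve_left hee)]
    obtain ⟨L, hL⟩ := ih (hdep b.state) (insert e F₁) F₂
    obtain ⟨L', hL'⟩ := ih (hdep !b.state) F₁ (insert e F₂)
    refine ⟨L + L', (hL.add hL').congr fun S => ?_⟩
    rw [← prob_union]
    · congr 1
      ext ω
      have hup : ∀ x, ω e = x → Function.update ω e x = ω := by
        rintro x rfl
        exact Function.update_eq_self e ω
      have hb : ω e = b.state ∨ ω e = !b.state := by
        cases ω e <;> cases b.state <;> simp
      have hnb : b.state ≠ !b.state := by cases b.state <;> simp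
      simp only [agreeEvent, Set.mem_inter_iff, Set.mem_ofPred_eq, Finset.mem_insert,
        forall_eq_or_imp, Set.mem_union, Set.mem_preimage]
      rcases hb with hb | hb
      · rw [hup _ hb]
        simp [hb, hnb]
      · rw [hup _ hb]
        simp [hb, hnb.symm]
    · rw [Set.disjoint_left]
      intro ω h1 h2
      have h3 : ω e = b.state := h1.2.1 e (Finset.mem_insert_self e _)
      rw [h2.2.2 e (Finset.mem_insert_self e _)] at h3
      cases b.state <;> simp at h3

/-- The limit of the finite-volume probabilities. -/
noncomputable def limitProb (b : BoundaryType) (p q : ℝ) (A : Set (Config d)) : ℝ :=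
  limUnder atTop fun S => prob b p q S A

include hp hq in
lemma tendsto_limitProb {A : Set (Config d)} (hA : DependsOnFinitelyManyEdges A) :
    Tendsto (fun S => prob b p q S A) atTop (𝓝 (limitProb b p q A)) :=
  tendsto_nhds_limUnder (exists_tendsto_prob hp hq hA)

include hp hq in
lemma limitProb_nonneg {A : Set (Config d)} (hA : DependsOnFinitelyManyEdges A) :
    0 ≤ limitProb b p q A :=
  ge_of_tendsto' (tendsto_limitProb hp hq hA) fun _ => prob_nonneg hp hq _

include hp hq in
lemma limitProb_union {A B : Set (Config d)} (hA : DependsOnFinitelyManyEdges A)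
    (hB : DependsOnFinitelyManyEdges B) (h : Disjoint A B) :
    limitProb b p q (A ∪ B) = limitProb b p q A + limitProb b p q B := by
  refine ((tendsto_limitProb hp hq hA).add (tendsto_limitProb hp hq hB)).congr
    (fun S => (prob_union h).symm) |>.limUnder_eq

include hp hq in
lemma limitProb_univ : limitProb (d := d) b p q Set.univ = 1 :=
  (tendsto_const_nhds.congr fun _ => (prob_univ hp hq).symm).limUnder_eq

lemma boxEdges_monotone (d : ℕ) : Monotone (boxEdges d) := by
  intro n m h e he
  obtain ⟨e, h'⟩ := e
  induction e with
  | h u v =>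
    rw [mem_boxEdges_mk, mem_boxVerts, mem_boxVerts] at he ⊢
    have : (n : ℤ) ≤ m := by exact_mod_cast h
    exact ⟨fun i => ⟨by linarith [(he.1 i).1], by linarith [(he.1 i).2]⟩,
      fun i => ⟨by linarith [(he.2 i).1], by linarith [(he.2 i).2]⟩⟩

lemma exists_mem_boxVerts (x : Vertex d) : ∃ n, x ∈ boxVerts d n := by
  refine ⟨∑ i, (x i).natAbs, mem_boxVerts.2 fun i => ?_⟩
  have : (x i).natAbs ≤ ∑ i, (x i).natAbs :=
    Finset.single_le_sum (f := fun i => (x i).natAbs) (fun _ _ => Nat.zero_le _) (Finset.mem_univ i)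
  omega

lemma boxVerts_monotone (d : ℕ) : Monotone (boxVerts d) := by
  intro n m h x hx
  rw [mem_boxVerts] at hx ⊢
  have : (n : ℤ) ≤ m := by exact_mod_cast h
  exact fun i => ⟨by linarith [(hx i).1], by linarith [(hx i).2]⟩

lemma tendsto_boxEdges (d : ℕ) : Tendsto (boxEdges d) atTop atTop := by
  refine tendsto_atTop_finset_of_monotone (boxEdges_monotone d) fun e => ?_
  obtain ⟨e, h⟩ := e
  induction e with
  | h u v =>
    obtain ⟨n, hn⟩ := exists_mem_boxVerts u
    obtain ⟨m, hm⟩ := exists_mem_boxVerts v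
    exact ⟨max n m, mem_boxEdges_mk.2 ⟨boxVerts_monotone d (le_max_left n m) hn,
      boxVerts_monotone d (le_max_right n m) hm⟩⟩

include hp hq in
lemma tendsto_finiteMeasure (hd : 1 ≤ d) {A : Set (Config d)} (hA : DependsOnFinitelyManyEdges A) :
    Tendsto (fun n : ℕ => finiteMeasure (box d n) (b.toSetoid (box d n)) p q
      (extend (box d n) ⁻¹' A)) atTop (𝓝 (ENNReal.ofReal (limitProb b p q A))) := by
  have h1 := (ENNReal.tendsto_ofReal (tendsto_limitProb (b := b) hp hq hA)).comp (tendsto_boxEdges d)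
  refine h1.congr' ?_
  obtain ⟨F, hF⟩ := hA
  filter_upwards [(tendsto_boxEdges d).eventually (eventually_ge_atTop F)] with n hn
  exact (finiteMeasure_box hd b hp hq hn hF).symm

include hp hq in
lemma isInfiniteVolumeMeasure_iff (hd : 1 ≤ d) {φ : Measure (Config d)} :
    IsInfiniteVolumeMeasure b p q φ ↔ IsProbabilityMeasure φ ∧
      ∀ A, DependsOnFinitelyManyEdges A → φ A = ENNReal.ofReal (limitProb b p q A) := by
  constructor
  · rintro ⟨h1, h2⟩
    exact ⟨h1, fun A hA => tendsto_nhds_unique (h2 A hA) (tendsto_finiteMeasure hp hq hd hA)⟩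
  · rintro ⟨h1, h2⟩
    exact ⟨h1, fun A hA => by rw [h2 A hA]; exact tendsto_finiteMeasure hp hq hd hA⟩

/-- The limit probabilities as an additive content on cylinder events. -/
noncomputable def limitContent (b : BoundaryType) :
    AddContent ENNReal (measurableCylinders fun _ : Edge d => Bool) :=
  isSetRing_measurableCylinders.addContent_of_union
    (fun A => ENNReal.ofReal (limitProb b p q A))
    (by
      have h : DependsOnFinitelyManyEdges (∅ : Set (Config d)) := ⟨∅, by simp⟩
      have := limitProb_union (b := b) hp hq h h (Set.disjoint_empty _)
      rw [Set.union_empty] at this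
      simp [show limitProb (d := d) b p q ∅ = 0 by linarith])
    (fun {A B} hA hB h => by
      rw [← dependsOnFinitelyManyEdges_iff] at hA hB
      rw [limitProb_union hp hq hA hB h,
        ENNReal.ofReal_add (limitProb_nonneg hp hq hA) (limitProb_nonneg hp hq hB)])

/-- A clopen set covered by countably many clopen sets is covered by finitely many of them, so
finite additivity suffices. -/
lemma isSigmaSubadditive_of_isClopen {X : Type*} [TopologicalSpace X] [CompactSpace X]
    {C : Set (Set X)} (hC : IsSetRing C) (hclopen : ∀ A ∈ C, IsClopen A)
    (m : AddContent ENNReal C) : m.IsSigmaSubadditive := by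
  intro f hf hU
  obtain ⟨t, ht⟩ := (hclopen _ hU).isClosed.isCompact.elim_finite_subcover f
    (fun i => (hclopen _ (hf i)).isOpen) subset_rfl
  calc m (⋃ i, f i) ≤ m (⋃ i ∈ t, f i) :=
        addContent_mono hC.isSetSemiring hU (hC.biUnion_mem t fun i _ => hf i) ht
    _ ≤ ∑ i ∈ t, m (f i) := addContent_biUnion_le hC fun i _ => hf i
    _ ≤ ∑' i, m (f i) := ENNReal.sum_le_tsum t

include hp hq in
theorem existsUnique_isInfiniteVolumeMeasure (hd : 1 ≤ d) (b : BoundaryType) :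
    ∃! φ : Measure (Config d), IsInfiniteVolumeMeasure b p q φ := by
  refine existsUnique_of_exists_of_unique ?_ ?_
  · let φ : Measure (Config d) := (limitContent hp hq b).measure isSetSemiring_measurableCylinders
      generateFrom_measurableCylinders.ge
      (isSigmaSubadditive_of_isClopen isSetRing_measurableCylinders
        (fun A hA => isClopen_of_mem_measurableCylinders hA) _)
    have hφ : ∀ A, DependsOnFinitelyManyEdges A → φ A = ENNReal.ofReal (limitProb b p q A) :=
      fun A hA => AddContent.measure_eq _ _ generateFrom_measurableCylinders.symm _
        hA.mem_measurableCylinders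
    refine ⟨φ, (isInfiniteVolumeMeasure_iff hp hq hd).2 ⟨⟨?_⟩, hφ⟩⟩
    rw [hφ _ ⟨∅, by simp⟩, limitProb_univ hp hq, ENNReal.ofReal_one]
  · intro φ ψ hφ hψ
    rw [isInfiniteVolumeMeasure_iff hp hq hd] at hφ hψ
    have := hφ.1
    refine ext_of_agreeEvent b.state fun F => ?_
    rw [hφ.2 _ (dependsOnFinitelyManyEdges_agreeEvent _ F),
      hψ.2 _ (dependsOnFinitelyManyEdges_agreeEvent _ F)]

end Limit

/-! ### Translations -/

/-- The translation by `x`. -/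
def shift (x : Vertex d) : lattice d ≃g lattice d where
  toEquiv := Equiv.addRight x
  map_rel_iff' := by
    intro u v
    change ∑ i, ((u + x) i - (v + x) i) ^ 2 = 1 ↔ ∑ i, (u i - v i) ^ 2 = 1
    simp

@[simp] lemma shift_apply (x y : Vertex d) : shift x y = y + x := rfl

lemma measurable_pull (τ : lattice d ≃g lattice d) : Measurable (pull (d := d) τ) :=
  measurable_pi_lambda _ fun _ => measurable_pi_apply _

lemma tendsto_moveEdges (τ : lattice d ≃g lattice d) :
    Tendsto (moveEdges τ) atTop atTop := by
  refine tendsto_atTop_finset_of_monotone (fun S R h => Finset.map_subset_map.2 h) fun e => ?_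
  obtain ⟨e, rfl⟩ := τ.mapEdgeSet.surjective e
  exact ⟨{e}, mapEdgeSet_mem_moveEdges.2 (Finset.mem_singleton_self e)⟩

lemma exists_subset_boxVerts (T : Finset (Vertex d)) : ∃ n, T ⊆ boxVerts d n := by
  classical
  induction T using Finset.induction with
  | empty => exact ⟨0, by simp⟩
  | insert x T _ ih =>
    obtain ⟨n, hn⟩ := ih
    obtain ⟨m, hm⟩ := exists_mem_boxVerts x
    exact ⟨max m n, Finset.insert_subset (boxVerts_monotone d (le_max_left m n) hm)
      (hn.trans (boxVerts_monotone d (le_max_right m n)))⟩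

lemma eventually_disjoint_endpoints (i : Fin d) (S : Finset (Edge d)) :
    ∀ᶠ k : ℕ in atTop, Disjoint (endpoints S)
      (endpoints (moveEdges (shift (Pi.single i (k : ℤ))) S)) := by
  obtain ⟨n, hn⟩ := exists_subset_boxVerts (endpoints S)
  -- Two vertices of `Λ_n` differ by at most `2 * n` in each coordinate.
  filter_upwards [eventually_gt_atTop (2 * n)] with k hk
  rw [Finset.disjoint_left]
  intro x hx hx'
  obtain ⟨y, rfl⟩ := (shift (Pi.single i (k : ℤ))).surjective x
  rw [endpoints_moveEdges] at hx'
  have h1 := (mem_boxVerts.1 (hn hx) i).2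
  have h2 := (mem_boxVerts.1 (hn hx') i).1
  simp only [shift_apply, Pi.add_apply, Pi.single_eq_same] at h1
  omega

lemma measurable_update [DecidableEq (Edge d)] (e : Edge d) (x : Bool) :
    Measurable fun ω : Config d => Function.update ω e x := by
  refine measurable_pi_lambda _ fun e' => ?_
  by_cases h : e' = e
  · subst h; simp
  · simp only [Function.update_of_ne h]
    exact measurable_pi_apply e'

/-! ### Invariance, mixing, the zero-one law and insertion tolerance -/

section Measure

variable {b : BoundaryType} {p q : ℝ} (hp : p ∈ Set.Icc (0 : ℝ) 1) (hq : 1 ≤ q)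

include hp hq in
-- The images of the finite edge sets under `τ` also exhaust the lattice, so the limit along them is
-- the same.
lemma limitProb_moveEdges (τ : lattice d ≃g lattice d) (F : Finset (Edge d)) :
    limitProb b p q (agreeEvent b.state (moveEdges τ F)) =
      limitProb b p q (agreeEvent b.state F) := by
  have h1 := (tendsto_limitProb (b := b) hp hq
    (dependsOnFinitelyManyEdges_agreeEvent b.state (moveEdges τ F))).comp (tendsto_moveEdges τ)
  refine tendsto_nhds_unique (h1.congr fun S => ?_) (tendsto_limitProb (b := b) hp hq
    (dependsOnFinitelyManyEdges_agreeEvent b.state F))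
  rw [Function.comp_apply, ← pull_preimage_agreeEvent, prob_moveEdges]

lemma dependsOnFinitelyManyEdges_agreeEvent_inter (s : Bool) (F F' : Finset (Edge d)) :
    DependsOnFinitelyManyEdges (agreeEvent s F ∩ agreeEvent s F') := by
  classical
  rw [← agreeEvent_union]
  exact dependsOnFinitelyManyEdges_agreeEvent _ _

include hp hq in
lemma limitProb_mul_le (F F' : Finset (Edge d)) :
    limitProb b p q (agreeEvent b.state F) * limitProb b p q (agreeEvent b.state F') ≤
      limitProb b p q (agreeEvent b.state F ∩ agreeEvent b.state F') :=
  le_of_tendsto_of_tendsto'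
    ((tendsto_limitProb hp hq (dependsOnFinitelyManyEdges_agreeEvent _ _)).mul
      (tendsto_limitProb hp hq (dependsOnFinitelyManyEdges_agreeEvent _ _)))
    (tendsto_limitProb hp hq (dependsOnFinitelyManyEdges_agreeEvent_inter _ _ _))
    fun _ => prob_mul_le_prob_inter hp hq F F'

include hp hq in
lemma limitProb_agreeEvent_le (F S : Finset (Edge d)) :
    limitProb b p q (agreeEvent b.state F) ≤ prob b p q S (agreeEvent b.state F) :=
  (prob_agreeEvent_antitone hp hq F).le_of_tendsto
    (tendsto_limitProb hp hq (dependsOnFinitelyManyEdges_agreeEvent _ _)) S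

include hp hq in
-- FKG and invariance give the lower bound for every `k`. For the upper bound, choose a domain `S`
-- whose two probabilities have product below `a`; once `S` and its translate share no vertex, their
-- union is a domain on which the probabilities multiply, and probabilities on a domain dominate the
-- limit.
lemma tendsto_limitProb_inter_moveEdges (i : Fin d) (F F' : Finset (Edge d)) :
    Tendsto (fun k : ℕ => limitProb b p q (agreeEvent b.state F ∩
      agreeEvent b.state (moveEdges (shift (Pi.single i (k : ℤ))) F'))) atTop
      (𝓝 (limitProb b p q (agreeEvent b.state F) * limitProb b p q (agreeEvent b.state F'))) := by
  classical
  refine tendsto_order.2 ⟨fun a ha => Eventually.of_forall fun k => ?_, fun a ha => ?_⟩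
  · refine ha.trans_le ?_
    rw [← limitProb_moveEdges hp hq (shift (Pi.single i (k : ℤ))) F']
    exact limitProb_mul_le hp hq _ _
  · have h1 := ((tendsto_limitProb (b := b) hp hq (dependsOnFinitelyManyEdges_agreeEvent b.state F)).mul
      (tendsto_limitProb (b := b) hp hq (dependsOnFinitelyManyEdges_agreeEvent b.state F')))
    obtain ⟨S, hS, hFS⟩ := ((h1.eventually (gt_mem_nhds ha)).and (eventually_ge_atTop (F ∪ F'))).exists
    filter_upwards [eventually_disjoint_endpoints i S] with k hk
    refine lt_of_le_of_lt ?_ hS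
    have hsub : moveEdges (shift (Pi.single i (k : ℤ))) F' ⊆
        moveEdges (shift (Pi.single i (k : ℤ))) S :=
      Finset.map_subset_map.2 (Finset.union_subset_right hFS)
    rw [← agreeEvent_union]
    refine (limitProb_agreeEvent_le hp hq _
      (S ∪ moveEdges (shift (Pi.single i (k : ℤ))) S)).trans_eq ?_
    rw [agreeEvent_union, prob_union_agreeEvent b p q hk (Finset.union_subset_left hFS)
      hsub, ← pull_preimage_agreeEvent,
      prob_moveEdges]

variable {φ : Measure (Config d)} [IsProbabilityMeasure φ]
  (hφ : ∀ A, DependsOnFinitelyManyEdges A → φ A = ENNReal.ofReal (limitProb b p q A))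

include hp hq hφ

lemma measurePreserving_pull (τ : lattice d ≃g lattice d) :
    MeasurePreserving (pull τ) φ φ := by
  refine ⟨measurable_pull τ, ?_⟩
  have := Measure.isProbabilityMeasure_map (μ := φ) (measurable_pull τ).aemeasurable
  refine ext_of_agreeEvent b.state fun F => ?_
  rw [Measure.map_apply (measurable_pull τ)
    (dependsOnFinitelyManyEdges_agreeEvent _ F).measurableSet, pull_preimage_agreeEvent,
    hφ _ (dependsOnFinitelyManyEdges_agreeEvent _ _), limitProb_moveEdges hp hq,
    hφ _ (dependsOnFinitelyManyEdges_agreeEvent _ _)]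

omit [IsProbabilityMeasure φ] in
lemma measureReal_eq_limitProb {A : Set (Config d)} (hA : DependsOnFinitelyManyEdges A) :
    φ.real A = limitProb b p q A := by
  rw [Measure.real, hφ A hA, ENNReal.toReal_ofReal (limitProb_nonneg hp hq hA)]

/-- Mixing along a coordinate axis. -/
lemma tendsto_measureReal_inter_pull (i : Fin d) (F : Finset (Edge d)) {B : Set (Config d)}
    (hB : MeasurableSet B) :
    Tendsto (fun k : ℕ => φ.real (agreeEvent b.state F ∩
      pull (shift (Pi.single i (k : ℤ))) ⁻¹' B)) atTop
      (𝓝 (φ.real (agreeEvent b.state F) * φ.real B)) := by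
  have hD : MeasurableSet (agreeEvent b.state F) :=
    (dependsOnFinitelyManyEdges_agreeEvent _ F).measurableSet
  have hm := fun k : ℕ => measurable_pull (shift (Pi.single i (k : ℤ)))
  induction B, hB using MeasurableSpace.induction_on_inter (generateFrom_agreeEvent b.state)
    (isPiSystem_agreeEvent b.state) with
  | empty => simp
  | basic B hB =>
    obtain ⟨F', rfl⟩ := hB
    have hdep := dependsOnFinitelyManyEdges_agreeEvent (d := d) b.state
    rw [measureReal_eq_limitProb hp hq hφ (hdep F), measureReal_eq_limitProb hp hq hφ (hdep F')]
    refine (tendsto_limitProb_inter_moveEdges hp hq i F F').congr fun k => ?_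
    rw [pull_preimage_agreeEvent, measureReal_eq_limitProb hp hq hφ
      (dependsOnFinitelyManyEdges_agreeEvent_inter _ _ _)]
  | compl B hB ih =>
    rw [probReal_compl_eq_one_sub hB, mul_sub, mul_one]
    refine (ih.const_sub _).congr fun k => ?_
    rw [Set.preimage_compl, ← Set.sdiff_eq, ← Set.sdiff_inter_self_eq_sdiff,
      Set.inter_comm (_ ⁻¹' B), measureReal_sdiff Set.inter_subset_left (hD.inter (hm k hB))]
  | iUnion f hf hfm ih =>
    have hsum : ∀ {g : ℕ → Set (Config d)}, Pairwise (Function.onFun Disjoint g) →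
        (∀ i, MeasurableSet (g i)) → HasSum (fun i => φ.real (g i)) (φ.real (⋃ i, g i)) :=
      fun h1 h2 => by
        rw [Measure.real, measure_iUnion h1 h2, ENNReal.tsum_toReal_eq fun i => measure_ne_top φ _]
        exact ENNReal.hasSum_toReal (by rw [← measure_iUnion h1 h2]; exact measure_ne_top φ _)
    have h1 : ∀ k : ℕ, ∑' j, φ.real (agreeEvent b.state F ∩
        pull (shift (Pi.single i (k : ℤ))) ⁻¹' f j) = φ.real (agreeEvent b.state F ∩
        pull (shift (Pi.single i (k : ℤ))) ⁻¹' ⋃ j, f j) := fun k => by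
      rw [Set.preimage_iUnion, Set.inter_iUnion]
      refine (hsum (fun j j' hj => ?_) fun j => hD.inter (hm k (hfm j))).tsum_eq
      exact ((hf hj).preimage _).mono Set.inter_subset_right Set.inter_subset_right
    simp only [← h1]
    rw [← (hsum hf hfm).tsum_eq, ← tsum_mul_left]
    -- By invariance the `j`-th term is at most `φ.real (f j)`, uniformly in `k`, and these bounds
    -- are summable.
    refine tendsto_tsum_of_dominated_convergence (hsum hf hfm).summable ih
      (Eventually.of_forall fun k j => ?_)
    rw [Real.norm_of_nonneg measureReal_nonneg]
    have h2 := (measurePreserving_pull hp hq hφ (shift (Pi.single i (k : ℤ)))).measureReal_preimage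
      (hfm j).nullMeasurableSet
    exact (measureReal_mono Set.inter_subset_right).trans_eq h2

/-- Events that are invariant under translations have probability zero or one. -/
theorem measure_eq_zero_or_one_of_invariant (hd : 1 ≤ d) {A : Set (Config d)} (hA : MeasurableSet A)
    (hinv : ∀ x, pull (shift x) ⁻¹' A = A) : φ A = 0 ∨ φ A = 1 := by
  -- Mixing with the invariant event `A` involves a constant sequence, so `A` is independent of
  -- every event of the generating family, hence of all events. Evaluating at `A` itself gives `φ A
  -- = φ A * φ A`.
  have key : φ.restrict A = φ A • φ := by
    refine ext_of_agreeEvent b.state fun F => ?_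
    have h1 := tendsto_measureReal_inter_pull hp hq hφ ⟨0, hd⟩ F hA
    simp only [hinv] at h1
    have h2 := tendsto_nhds_unique h1 tendsto_const_nhds
    rw [Measure.restrict_apply (dependsOnFinitelyManyEdges_agreeEvent _ F).measurableSet,
      Measure.smul_apply, smul_eq_mul, mul_comm, ← ENNReal.toReal_eq_toReal_iff' (by finiteness)
        (by finiteness), ENNReal.toReal_mul]
    exact h2.symm
  have h := congrArg (fun μ => μ A) key
  simp only [Measure.restrict_apply hA, Set.inter_self, Measure.smul_apply, smul_eq_mul] at h
  by_cases h0 : φ A = 0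
  · exact Or.inl h0
  · refine Or.inr ?_
    have h3 : φ A * 1 = φ A * φ A := by rw [mul_one]; exact h
    exact ((ENNReal.mul_right_inj h0 (measure_ne_top _ _)).1 h3).symm

/-! ### Insertion tolerance -/

omit [IsProbabilityMeasure φ] in
lemma measure_preimage_update_le [DecidableEq (Edge d)] (hp0 : 0 < p) (e : Edge d)
    {A : Set (Config d)} (hA : DependsOnFinitelyManyEdges A) :
    φ ((fun ω => Function.update ω e true) ⁻¹' A) ≤ ENNReal.ofReal (1 + q / p) * φ A := by
  have hA' : DependsOnFinitelyManyEdges ((fun ω => Function.update ω e true) ⁻¹' A) := by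
    obtain ⟨F, hF⟩ := hA
    refine ⟨F, fun ω ω' h => hF _ _ fun e' he' => ?_⟩
    by_cases hee : e' = e
    · subst hee; simp
    · simp [Function.update_of_ne hee, h e' he']
  rw [hφ _ hA, hφ _ hA', ← ENNReal.ofReal_mul (by positivity)]
  refine ENNReal.ofReal_le_ofReal (le_of_tendsto_of_tendsto (tendsto_limitProb hp hq hA')
    ((tendsto_limitProb hp hq hA).const_mul _) ?_)
  filter_upwards [eventually_ge_atTop {e}] with S hS
  exact prob_preimage_update_le hp hq hp0 (Finset.singleton_subset_iff.1 hS) A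

/-- The bound for cylinder events passes to null sets by approximation with a cylinder event `t`,
close to `B` both for `φ` and for its image under `T`; using the sum of the two measures controls
both errors at once. -/
lemma measure_preimage_update_eq_zero [DecidableEq (Edge d)] (hp0 : 0 < p) (e : Edge d)
    {B : Set (Config d)} (hB : φ B = 0) : φ ((fun ω => Function.update ω e true) ⁻¹' B) = 0 := by
  set T : Config d → Config d := fun ω => Function.update ω e true with hT
  have hTm : Measurable T := measurable_update e true
  wlog hBm : MeasurableSet B generalizing B
  · exact measure_mono_null (Set.preimage_mono (subset_toMeasurable φ B))
      (this ((measure_toMeasurable B).trans hB) (measurableSet_toMeasurable φ B))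
  have := Measure.isProbabilityMeasure_map (μ := φ) hTm.aemeasurable
  have hdense := Measure.MeasureDense.of_generateFrom_isSetAlgebra_finite (μ := φ + φ.map T)
    isSetAlgebra_measurableCylinders (generateFrom_measurableCylinders (α := fun _ : Edge d => Bool)).symm
  set C := ENNReal.ofReal (1 + q / p) with hC
  have hbound : ∀ ε : ℝ, 0 < ε → φ (T ⁻¹' B) ≤ (C + 1) * ENNReal.ofReal ε := by
    intro ε hε
    obtain ⟨t, ht, hlt⟩ := hdense.approx B hBm (measure_ne_top _ _) ε hε
    have htm : MeasurableSet t := .of_mem_measurableCylinders ht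
    rw [Measure.add_apply, Measure.map_apply hTm (hBm.symmDiff htm)] at hlt
    have h1 : φ t ≤ ENNReal.ofReal ε := by
      calc φ t ≤ φ (B ∪ symmDiff B t) := measure_mono fun x hx => by
            by_cases hxB : x ∈ B
            · exact Or.inl hxB
            · exact Or.inr (Or.inr ⟨hx, hxB⟩)
        _ ≤ φ B + φ (symmDiff B t) := measure_union_le _ _
        _ ≤ ENNReal.ofReal ε := by
            rw [hB, zero_add]
            exact le_self_add.trans hlt.le
    have h2 := measure_preimage_update_le hp hq hφ hp0 e (dependsOnFinitelyManyEdges_iff.2 ht)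
    calc φ (T ⁻¹' B) ≤ φ (T ⁻¹' t ∪ T ⁻¹' symmDiff B t) := measure_mono fun x hx => by
            by_cases hxt : T x ∈ t
            · exact Or.inl hxt
            · exact Or.inr (Or.inl ⟨hx, hxt⟩)
      _ ≤ φ (T ⁻¹' t) + φ (T ⁻¹' symmDiff B t) := measure_union_le _ _
      _ ≤ C * ENNReal.ofReal ε + ENNReal.ofReal ε := by
          refine add_le_add (h2.trans ?_) (le_add_self.trans hlt.le)
          gcongr
      _ = _ := by rw [add_mul, one_mul]
  have hlim : Tendsto (fun ε : ℝ => (C + 1) * ENNReal.ofReal ε) (𝓝[>] 0) (𝓝 0) := by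
    have h1 : Tendsto (fun ε : ℝ => ENNReal.ofReal ε) (𝓝[>] 0) (𝓝 0) := by
      have := (ENNReal.continuous_ofReal.tendsto 0).mono_left
        (nhdsWithin_le_nhds (s := Set.Ioi (0 : ℝ)))
      simpa using this
    have := ENNReal.Tendsto.const_mul (a := C + 1) h1 (Or.inr (by finiteness))
    simpa using this
  exact le_antisymm (ge_of_tendsto hlim (by
    filter_upwards [self_mem_nhdsWithin] with ε hε using hbound ε hε)) bot_le

open Classical in
/-- The configuration `ω` with the edges of `F` opened. -/
noncomputable def openEdges (F : Set (Edge d)) (ω : Config d) : Config d :=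
  fun e => if e ∈ F then true else ω e

/-- There are countably many finite edge sets, and each can be opened one edge at a time. -/
lemma ae_forall_openEdges (hp0 : 0 < p) {P : Config d → Prop} (hP : ∀ᵐ ω ∂φ, P ω) :
    ∀ᵐ ω ∂φ, ∀ F : Finset (Edge d), P (openEdges (F : Set (Edge d)) ω) := by
  classical
  rw [ae_all_iff]
  intro F
  induction F using Finset.induction with
  | empty =>
    filter_upwards [hP] with ω hω
    have : openEdges ((∅ : Finset (Edge d)) : Set (Edge d)) ω = ω := by ext; simp [openEdges]
    rwa [this]
  | insert e F he ih =>
    have h := measure_preimage_update_eq_zero hp hq hφ hp0 e (ae_iff.1 ih)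
    refine ae_iff.2 (measure_mono_null (fun ω hω => ?_) h)
    refine fun h' => hω ?_
    have h' : P (openEdges (F : Set (Edge d)) (Function.update ω e true)) := h'
    convert h' using 1
    funext e'
    by_cases h1 : e' ∈ F <;> by_cases h2 : e' = e <;> simp [openEdges, h1, h2]

end Measure

/-! ### Connectivity of the lattice -/

lemma lattice_reachable_add_single (x : Vertex d) (i : Fin d) (z : ℤ) :
    (lattice d).Reachable x (x + Pi.single i z) := by
  induction z using Int.induction_on with
  | zero => simp
  | succ n ih =>
    refine ih.trans (SimpleGraph.Adj.reachable ?_)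
    have := lattice_adj_add_single (x + Pi.single i (n : ℤ)) i
    rwa [add_assoc, ← Pi.single_add] at this
  | pred n ih =>
    refine ih.trans (SimpleGraph.Adj.reachable (SimpleGraph.Adj.symm ?_))
    have := lattice_adj_add_single (x + Pi.single i (-(n : ℤ) - 1)) i
    rwa [add_assoc, ← Pi.single_add, sub_add_cancel] at this

lemma lattice_preconnected (d : ℕ) : (lattice d).Preconnected := by
  have h : ∀ x : Vertex d, (lattice d).Reachable 0 x := by
    intro x
    have key : ∀ s : Finset (Fin d), (lattice d).Reachable 0 (∑ i ∈ s, Pi.single i (x i)) := by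
      intro s
      induction s using Finset.induction with
      | empty => simp
      | insert i s hi ih =>
        rw [Finset.sum_insert hi, add_comm]
        exact ih.trans (lattice_reachable_add_single _ _ _)
    have := key Finset.univ
    rwa [Finset.univ_sum_single] at this
  exact fun x y => (h x).symm.trans (h y)

lemma mem_boxVerts_succ_of_adj {n : ℕ} {x y : Vertex d} (h : (lattice d).Adj x y)
    (hx : x ∈ boxVerts d n) : y ∈ boxVerts d (n + 1) := by
  rw [mem_boxVerts] at hx ⊢
  intro i
  have h1 : ∑ j, (x j - y j) ^ 2 = 1 := h
  have h2 : (x i - y i) ^ 2 ≤ 1 := by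
    rw [← h1]
    exact Finset.single_le_sum (f := fun j => (x j - y j) ^ 2) (fun j _ => sq_nonneg _)
      (Finset.mem_univ i)
  have h3 := abs_le.1 ((sq_le_one_iff_abs_le_one _).1 h2)
  have h4 := hx i
  push_cast
  constructor <;> linarith [h3.1, h3.2, h4.1, h4.2]

/-! ### Infinite clusters -/

lemma connectedToInfinity_iff {ω : Config d} {x : Vertex d} :
    ConnectedToInfinity ω x ↔ {y | (openGraph ω).Reachable x y}.Infinite := by
  unfold ConnectedToInfinity
  have : ((openGraph ω).connectedComponentMk x).supp = {y | (openGraph ω).Reachable x y} := by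
    ext y
    rw [SimpleGraph.ConnectedComponent.mem_supp_iff, SimpleGraph.ConnectedComponent.eq]
    exact ⟨fun h => h.symm, fun h => h.symm⟩
  rw [this]

lemma ConnectedToInfinity.mono {ω ω' : Config d} (h : ω ≤ ω') {x : Vertex d}
    (hx : ConnectedToInfinity ω x) : ConnectedToInfinity ω' x := by
  rw [connectedToInfinity_iff] at hx ⊢
  exact Set.Infinite.mono (fun y hy => SimpleGraph.Reachable.mono (openGraph_mono h) hy) hx

/-- There is exactly one infinite cluster, in terms of vertices. -/
def UniqueInfinite (ω : Config d) : Prop :=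
  ∃ x, ConnectedToInfinity ω x ∧ ∀ y, ConnectedToInfinity ω y → (openGraph ω).Reachable x y

lemma existsUnique_cluster {ω : Config d} (h : UniqueInfinite ω) :
    ∃! C : Cluster ω, C.supp.Infinite := by
  obtain ⟨x, hx, h⟩ := h
  refine ⟨(openGraph ω).connectedComponentMk x, hx, fun C hC => ?_⟩
  induction C using SimpleGraph.ConnectedComponent.ind with
  | h y => exact SimpleGraph.ConnectedComponent.eq.2 (h y hC).symm

/-! ### Opening and closing all edges at a finite set of vertices -/

/-- The edges that have an endpoint in `K`. -/
def touching (K : Finset (Vertex d)) : Set (Edge d) := {e | ∃ x ∈ K, x ∈ e.1}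

lemma finite_touching (K : Finset (Vertex d)) : (touching K).Finite := by
  obtain ⟨n, hn⟩ := exists_subset_boxVerts K
  refine (boxEdges d (n + 1)).finite_toSet.subset ?_
  rintro ⟨e, he⟩ ⟨x, hxK, hxe⟩
  obtain ⟨y, rfl⟩ := Sym2.mem_iff_exists.1 hxe
  exact mem_boxEdges_mk.2 ⟨boxVerts_monotone d (Nat.le_succ n) (hn hxK),
    mem_boxVerts_succ_of_adj he (hn hxK)⟩

/-- All edges at `K` opened. -/
noncomputable def join (K : Finset (Vertex d)) (ω : Config d) : Config d :=
  openEdges (touching K) ω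

open Classical in
/-- All edges at `K` closed. -/
noncomputable def cut (K : Finset (Vertex d)) (ω : Config d) : Config d :=
  fun e => if e ∈ touching K then false else ω e

lemma le_join (K : Finset (Vertex d)) (ω : Config d) : ω ≤ join K ω := by
  intro e
  by_cases h : e ∈ touching K <;> simp [join, openEdges, h, Bool.le_true]

lemma cut_le (K : Finset (Vertex d)) (ω : Config d) : cut K ω ≤ ω := by
  intro e
  by_cases h : e ∈ touching K <;> simp [cut, h, Bool.false_le]

lemma cut_join (K : Finset (Vertex d)) (ω : Config d) : cut K (join K ω) = cut K ω := by
  ext e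
  by_cases h : e ∈ touching K <;> simp [cut, join, openEdges, h]

lemma join_of_mem_touching {K : Finset (Vertex d)} {ω : Config d} {e : Edge d}
    (h : e ∈ touching K) : join K ω e = true := by simp [join, openEdges, h]

lemma openGraph_cut_adj {K : Finset (Vertex d)} {ω : Config d} {x y : Vertex d} :
    (openGraph (cut K ω)).Adj x y ↔ (openGraph ω).Adj x y ∧ x ∉ K ∧ y ∉ K := by
  rw [openGraph_adj, openGraph_adj]
  constructor
  · rintro ⟨h, h'⟩
    by_cases ht : (⟨s(x, y), h⟩ : Edge d) ∈ touching K
    · simp [cut, ht] at h'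
    · refine ⟨⟨h, by simpa [cut, ht] using h'⟩, fun hx => ht ⟨x, hx, by simp⟩,
        fun hy => ht ⟨y, hy, by simp⟩⟩
  · rintro ⟨⟨h, h'⟩, hx, hy⟩
    refine ⟨h, ?_⟩
    have ht : (⟨s(x, y), h⟩ : Edge d) ∉ touching K := by
      rintro ⟨z, hz, hze⟩
      rcases Sym2.mem_iff.1 hze with rfl | rfl
      · exact hx hz
      · exact hy hz
    simpa [cut, ht] using h'

lemma openGraph_adj_of_touching {K : Finset (Vertex d)} {ω : Config d}
    (hω : ∀ e ∈ touching K, ω e = true) {x y : Vertex d} (h : (lattice d).Adj x y) (hx : x ∈ K) :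
    (openGraph ω).Adj x y :=
  openGraph_adj.2 ⟨h, hω _ ⟨x, hx, by simp⟩⟩

lemma reachable_of_mem {K : Finset (Vertex d)} {ω : Config d}
    (hK : ((lattice d).induce (K : Set (Vertex d))).Connected)
    (hω : ∀ x ∈ K, ∀ y ∈ K, (lattice d).Adj x y → (openGraph ω).Adj x y) {x y : Vertex d}
    (hx : x ∈ K) (hy : y ∈ K) : (openGraph ω).Reachable x y := by
  let f : (lattice d).induce (K : Set (Vertex d)) →g openGraph ω :=
    { toFun := Subtype.val
      map_rel' := fun {a b} h => hω a.1 a.2 b.1 b.2 h }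
  exact (hK.preconnected ⟨x, hx⟩ ⟨y, hy⟩).map f

/-- Opening the edges at `K` merges every cluster that meets `K`. A cluster that still avoids `K`
afterwards was not changed, so it cannot be infinite. -/
lemma uniqueInfinite_join {K : Finset (Vertex d)} {ω : Config d}
    (hK : ((lattice d).induce (K : Set (Vertex d))).Connected) {x : Vertex d} (hxK : x ∈ K)
    (hx : ConnectedToInfinity ω x)
    (h : ∀ y, ConnectedToInfinity ω y → ∃ z ∈ K, (openGraph ω).Reachable y z) :
    UniqueInfinite (join K ω) := by
  have hKK : ∀ z ∈ K, (openGraph (join K ω)).Reachable x z := fun z hz =>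
    reachable_of_mem hK (fun a ha b _ hab =>
      openGraph_adj_of_touching (fun e he => join_of_mem_touching he) hab ha) hxK hz
  refine ⟨x, hx.mono (le_join K ω), fun y hy => ?_⟩
  by_contra hxy
  have key : ∀ z, (openGraph (join K ω)).Reachable y z → (openGraph ω).Reachable y z := by
    intro z hz
    rw [SimpleGraph.reachable_iff_reflTransGen] at hz
    induction hz with
    | refl => rfl
    | @tail u v huv hadj ih =>
      refine ih.trans (SimpleGraph.Adj.reachable ?_)
      rw [← SimpleGraph.reachable_iff_reflTransGen] at huv
      obtain ⟨h1, h2⟩ := openGraph_adj.1 hadj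
      have ht : (⟨s(u, v), h1⟩ : Edge d) ∉ touching K := by
        rintro ⟨w, hw, hwe⟩
        rcases Sym2.mem_iff.1 hwe with rfl | rfl
        · exact hxy ((hKK _ hw).trans huv.symm)
        · exact hxy ((hKK _ hw).trans (huv.trans hadj.reachable).symm)
      exact openGraph_adj.2 ⟨h1, by simpa [join, openEdges, ht] using h2⟩
  have hy' : ConnectedToInfinity ω y := by
    rw [connectedToInfinity_iff] at hy ⊢
    exact hy.mono key
  obtain ⟨z, hzK, hyz⟩ := h y hy'
  exact hxy ((hKK z hzK).trans (hyz.mono (openGraph_mono (le_join K ω))).symm)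

/-! ### Trifurcations -/

/-- All edges at `K` are open, and closing them leaves at least three infinite clusters next to
`K`. -/
def Trifurcation (K : Finset (Vertex d)) (ω : Config d) : Prop :=
  (∀ e ∈ touching K, ω e = true) ∧ ∃ v : Fin 3 → Vertex d,
    (∀ i, ∃ k ∈ K, (lattice d).Adj k (v i)) ∧ (∀ i, ConnectedToInfinity (cut K ω) (v i)) ∧
    ∀ i j, i ≠ j → ¬ (openGraph (cut K ω)).Reachable (v i) (v j)

/-- Off `K`, the cluster is the union of the pieces attached to the finitely many neighbours of `K`,
so one of these pieces is infinite. -/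
lemma exists_connectedToInfinity_cut {K : Finset (Vertex d)} {ω : Config d} {x : Vertex d}
    (hxK : x ∈ K) (hx : ConnectedToInfinity ω x) :
    ∃ v, (∃ k ∈ K, (lattice d).Adj k v) ∧ (openGraph ω).Reachable x v ∧
      ConnectedToInfinity (cut K ω) v := by
  have key : ∀ y, (openGraph ω).Reachable x y → y ∈ K ∨ ∃ v, (∃ k ∈ K, (lattice d).Adj k v) ∧
      (openGraph ω).Reachable x v ∧ (openGraph (cut K ω)).Reachable v y := by
    intro y hy
    rw [SimpleGraph.reachable_iff_reflTransGen] at hy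
    induction hy with
    | refl => exact Or.inl hxK
    | @tail u w huw hadj ih =>
      rw [← SimpleGraph.reachable_iff_reflTransGen] at huw
      by_cases hw : w ∈ K
      · exact Or.inl hw
      · right
        by_cases hu : u ∈ K
        · exact ⟨w, ⟨u, hu, openGraph_le_lattice _ hadj⟩, huw.trans hadj.reachable, by rfl⟩
        · obtain ⟨v, h1, h2, h3⟩ := ih.resolve_left hu
          exact ⟨v, h1, h2, h3.trans (openGraph_cut_adj.2 ⟨hadj, hu, hw⟩).reachable⟩
  by_contra hcon
  push Not at hcon
  rw [connectedToInfinity_iff] at hx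
  refine hx ?_
  obtain ⟨n, hn⟩ := exists_subset_boxVerts K
  have hfin : {v | (∃ k ∈ K, (lattice d).Adj k v) ∧ (openGraph ω).Reachable x v}.Finite := by
    refine (boxVerts d (n + 1)).finite_toSet.subset ?_
    rintro v ⟨⟨k, hk, hkv⟩, -⟩
    exact mem_boxVerts_succ_of_adj hkv (hn hk)
  have hunion : ((K : Set (Vertex d)) ∪
      ⋃ v ∈ {v | (∃ k ∈ K, (lattice d).Adj k v) ∧ (openGraph ω).Reachable x v},
        {y | (openGraph (cut K ω)).Reachable v y}).Finite := by
    refine K.finite_toSet.union (hfin.biUnion fun v hv => ?_)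
    have := hcon v hv.1 hv.2
    rwa [connectedToInfinity_iff, Set.not_infinite] at this
  refine hunion.subset fun y hy => ?_
  rcases key y hy with h | ⟨v, h1, h2, h3⟩
  · exact Or.inl h
  · exact Or.inr (Set.mem_biUnion (show v ∈ {v | _ ∧ _} from ⟨h1, h2⟩) h3)

lemma trifurcation_join {K : Finset (Vertex d)} {ω : Config d} {x : Fin 3 → Vertex d}
    (hxK : ∀ i, x i ∈ K) (hx : ∀ i, ConnectedToInfinity ω (x i))
    (hxx : ∀ i j, i ≠ j → ¬ (openGraph ω).Reachable (x i) (x j)) : Trifurcation K (join K ω) := by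
  refine ⟨fun e he => join_of_mem_touching he, ?_⟩
  choose v h1 h2 h3 using fun i => exists_connectedToInfinity_cut (hxK i) (hx i)
  rw [cut_join]
  refine ⟨v, h1, h3, fun i j hij h => hxx i j hij ?_⟩
  exact ((h2 i).trans (h.mono (openGraph_mono (cut_le K ω)))).trans (h2 j).symm

/-- With one or two infinite clusters, a finite connected `K` meeting all of them would make the
infinite cluster unique. So there are three different ones, and a connected `K` meeting these
becomes a trifurcation. -/
lemma exists_trifurcation_join {ω : Config d} (hω : ∃ x, ConnectedToInfinity ω x)
    (hn : ∀ K : Finset (Vertex d), ¬ UniqueInfinite (join K ω)) :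
    ∃ K : Finset (Vertex d), ((lattice d).induce (K : Set (Vertex d))).Connected ∧
      Trifurcation K (join K ω) := by
  classical
  have ext := fun (t : Finset (Vertex d)) (ht : t.Nonempty) =>
    SimpleGraph.extend_finset_to_connected (lattice_preconnected d) ht
  obtain ⟨x, hx⟩ := hω
  obtain ⟨y, hy, hxy⟩ : ∃ y, ConnectedToInfinity ω y ∧ ¬ (openGraph ω).Reachable y x := by
    by_contra! hcon
    obtain ⟨K, hxK, hK⟩ := ext {x} (Finset.singleton_nonempty x)
    have hxK := hxK (Finset.mem_singleton_self x)
    exact hn K (uniqueInfinite_join hK hxK hx fun y hy => ⟨x, hxK, hcon y hy⟩)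
  obtain ⟨z, hz, hzx, hzy⟩ : ∃ z, ConnectedToInfinity ω z ∧ ¬ (openGraph ω).Reachable z x ∧
      ¬ (openGraph ω).Reachable z y := by
    by_contra! hcon
    obtain ⟨K, hxK, hK⟩ := ext {x, y} (by simp)
    have h1 : x ∈ K := hxK (by simp)
    have h2 : y ∈ K := hxK (by simp)
    refine hn K (uniqueInfinite_join hK h1 hx fun z hz => ?_)
    by_cases hzx : (openGraph ω).Reachable z x
    · exact ⟨x, h1, hzx⟩
    · exact ⟨y, h2, hcon z hz hzx⟩
  obtain ⟨K, hsub, hK⟩ := ext {x, y, z} (by simp)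
  refine ⟨K, hK, trifurcation_join (x := ![x, y, z]) ?_ ?_ ?_⟩
  · intro i
    apply hsub
    fin_cases i <;> simp
  · intro i
    fin_cases i <;> assumption
  · intro i j hij h
    fin_cases i <;> fin_cases j <;>
      first
        | exact hij rfl
        | exact hxy h
        | exact hxy h.symm
        | exact hzx h
        | exact hzx h.symm
        | exact hzy h
        | exact hzy h.symm

/-! ### The number of disjoint trifurcations in a box -/

section Counting

variable {ω : Config d}

lemma reachable_cut_of_mem {K K' : Finset (Vertex d)} (hd : Disjoint K K')
    (hK' : ((lattice d).induce (K' : Set (Vertex d))).Connected)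
    (hω : ∀ e ∈ touching K', ω e = true) {x y : Vertex d} (hx : x ∈ K') (hy : y ∈ K') :
    (openGraph (cut K ω)).Reachable x y :=
  reachable_of_mem hK' (fun _ ha _ hb hab => openGraph_cut_adj.2
    ⟨openGraph_adj_of_touching hω hab ha, Finset.disjoint_right.1 hd ha,
      Finset.disjoint_right.1 hd hb⟩) hx hy

/-- A branch of `K'` that does not reach the point `c` of `K` avoids `K` entirely, since `K` is
connected by open edges that cutting `K'` spares. Such a branch survives cutting `K` and stays
attached to `K'`. -/
lemma reachable_cut_of_not_reachable {K K' : Finset (Vertex d)} (hd : Disjoint K K')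
    (hK : ((lattice d).induce (K : Set (Vertex d))).Connected)
    (hK' : ((lattice d).induce (K' : Set (Vertex d))).Connected)
    (hω : ∀ e ∈ touching K, ω e = true) (hω' : ∀ e ∈ touching K', ω e = true)
    {v w c c' : Vertex d} (hc : c ∈ K) (hc' : c' ∈ K') (hv : ∃ k ∈ K', (lattice d).Adj k v)
    (hn : ¬ (openGraph (cut K' ω)).Reachable v c) (h : (openGraph (cut K' ω)).Reachable v w) :
    (openGraph (cut K ω)).Reachable c' w := by
  have hnK : ∀ u, (openGraph (cut K' ω)).Reachable v u → u ∉ K := fun u hu huK =>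
    hn (hu.trans (reachable_cut_of_mem hd.symm hK hω huK hc))
  obtain ⟨k, hk, hkv⟩ := hv
  have h1 : (openGraph (cut K ω)).Reachable c' v :=
    (reachable_cut_of_mem hd hK' hω' hc' hk).trans (openGraph_cut_adj.2
      ⟨openGraph_adj_of_touching hω' hkv hk, Finset.disjoint_right.1 hd hk, hnK v (by rfl)⟩).reachable
  refine h1.trans ?_
  rw [SimpleGraph.reachable_iff_reflTransGen] at h
  induction h with
  | refl => rfl
  | @tail u w huw hadj ih =>
    rw [← SimpleGraph.reachable_iff_reflTransGen] at huw
    exact ih.trans (openGraph_cut_adj.2 ⟨(openGraph_cut_adj.1 hadj).1, hnK u huw,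
      hnK w (huw.trans hadj.reachable)⟩).reachable

/-- The vertices at distance `n + 1` from the origin in the supremum norm. -/
noncomputable def sphere (d n : ℕ) : Finset (Vertex d) := boxVerts d (n + 1) \ boxVerts d n

/-- An infinite cluster leaves the box, and an edge leaving it ends on the sphere. -/
lemma exists_mem_sphere {n : ℕ} {v : Vertex d} (hv : v ∈ boxVerts d (n + 1))
    (hinf : ConnectedToInfinity ω v) : ∃ z ∈ sphere d n, (openGraph ω).Reachable v z := by
  by_cases hvn : v ∈ boxVerts d n
  · rw [connectedToInfinity_iff] at hinf
    obtain ⟨y, hy, hyn⟩ := hinf.exists_notMem_finset (boxVerts d n)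
    rw [Set.mem_ofPred_eq, SimpleGraph.reachable_iff_reflTransGen] at hy
    induction hy with
    | refl => exact absurd hvn hyn
    | @tail u w huw hadj ih =>
      rw [← SimpleGraph.reachable_iff_reflTransGen] at huw
      by_cases hu : u ∈ boxVerts d n
      · exact ⟨w, Finset.mem_sdiff.2 ⟨mem_boxVerts_succ_of_adj (openGraph_le_lattice _ hadj) hu, hyn⟩,
          huw.trans hadj.reachable⟩
      · exact ih hu
  · exact ⟨v, Finset.mem_sdiff.2 ⟨hv, hvn⟩, by rfl⟩

/-- An injection into the sphere. Sphere vertices are ranked by an arbitrary numbering `enc`; `M t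
i` is the top-ranked one in branch `i` of `t`, and `t` is sent to the lowest of its three values.
Two trifurcations sharing an image would each have a branch containing too much of the other. -/
theorem card_trifurcation_le {ι : Type*} (I : Finset ι) (K : ι → Finset (Vertex d)) {n : ℕ}
    (hconn : ∀ t, ((lattice d).induce (K t : Set (Vertex d))).Connected)
    (hdisj : ∀ t ∈ I, ∀ t' ∈ I, t ≠ t' → Disjoint (K t) (K t')) (hbox : ∀ t ∈ I, K t ⊆ boxVerts d n)
    (htri : ∀ t ∈ I, Trifurcation (K t) ω) : I.card ≤ (sphere d n).card := by
  classical
  obtain ⟨enc, henc⟩ := exists_injective_nat (Vertex d)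
  have hex : ∀ t : I, ∃ (v : Fin 3 → Vertex d) (M : Fin 3 → Vertex d),
      (∀ i, ∃ k ∈ K t, (lattice d).Adj k (v i)) ∧
      (∀ i j, i ≠ j → ¬ (openGraph (cut (K t) ω)).Reachable (v i) (v j)) ∧
      (∀ i, M i ∈ sphere d n) ∧ (∀ i, (openGraph (cut (K t) ω)).Reachable (v i) (M i)) ∧
      ∀ i, ∀ z ∈ sphere d n, (openGraph (cut (K t) ω)).Reachable (v i) z → enc z ≤ enc (M i) := by
    rintro ⟨t, ht⟩
    obtain ⟨-, v, h1, h2, h3⟩ := htri t ht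
    have hM : ∀ i, ∃ z ∈ (sphere d n).filter fun z => (openGraph (cut (K t) ω)).Reachable (v i) z,
        ∀ z' ∈ (sphere d n).filter fun z => (openGraph (cut (K t) ω)).Reachable (v i) z,
        enc z' ≤ enc z := by
      intro i
      obtain ⟨k, hk, hkv⟩ := h1 i
      obtain ⟨z, hz, hvz⟩ := exists_mem_sphere
        (mem_boxVerts_succ_of_adj hkv (hbox t ht hk)) (h2 i)
      exact Finset.exists_max_image _ enc ⟨z, Finset.mem_filter.2 ⟨hz, hvz⟩⟩
    choose M hM hmax using hM
    simp only [Finset.mem_filter, and_imp] at hM hmax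
    exact ⟨v, M, h1, h3, fun i => (hM i).1, fun i => (hM i).2, hmax⟩
  choose v M hadj hsep hsph hreach hmax using hex
  have hmin : ∀ t, ∃ i, ∀ j, enc (M t i) ≤ enc (M t j) := fun t => by
    obtain ⟨i, -, hi⟩ := Finset.exists_min_image Finset.univ (fun i => enc (M t i)) ⟨0, by simp⟩
    exact ⟨i, fun j => hi j (Finset.mem_univ j)⟩
  choose m hm using hmin
  have hMinj : ∀ t i j, M t i = M t j → i = j := fun t i j h => by
    by_contra hij
    exact hsep t i j hij ((hreach t i).trans (h ▸ (hreach t j).symm))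
  choose c hc using fun t : I => (⟨⟨_, (hconn t).nonempty.some.2⟩⟩ : Nonempty (K t.1)).elim
    fun x => (⟨x.1, x.2⟩ : ∃ x, x ∈ K t.1)
  have hd : ∀ {t t' : I}, t ≠ t' → Disjoint (K t) (K t') := fun {t t'} h =>
    hdisj t t.2 t' t'.2 fun h' => h (Subtype.ext h')
  have key : ∀ {t t' : I}, t ≠ t' → ∀ {j w}, ¬ (openGraph (cut (K t') ω)).Reachable (v t' j) (c t) →
      (openGraph (cut (K t') ω)).Reachable (v t' j) w →
      (openGraph (cut (K t) ω)).Reachable (c t') w := fun {t t'} h {j w} h1 h2 =>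
    reachable_cut_of_not_reachable (hd h) (hconn t) (hconn t') (htri t t.2).1 (htri t' t'.2).1
      (hc t) (hc t') (hadj t' j) h1 h2
  -- If the chosen branch of `t` contained `K t'`, it would contain every branch of `t'` not leading
  -- back to `t`. At most one branch leads back, so some `j ≠ m t'` qualifies, and `M t' j` ranks at
  -- most as high as the common image. As that image is the minimum over the branches of `t'`, the
  -- two coincide, which contradicts `j ≠ m t'`.
  have caseA : ∀ t t' : I, t ≠ t' → M t (m t) = M t' (m t') →
      ¬ (openGraph (cut (K t) ω)).Reachable (c t') (M t (m t)) := by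
    intro t t' hne hM h
    obtain ⟨j, hj, hjc⟩ : ∃ j, j ≠ m t' ∧
        ¬ (openGraph (cut (K t') ω)).Reachable (v t' j) (c t) := by
      by_contra! hcon
      obtain ⟨i, j, hi, hj, hij⟩ : ∃ i j : Fin 3, i ≠ m t' ∧ j ≠ m t' ∧ i ≠ j := by
        generalize m t' = a
        fin_cases a
        · exact ⟨1, 2, by decide, by decide, by decide⟩
        · exact ⟨0, 2, by decide, by decide, by decide⟩
        · exact ⟨0, 1, by decide, by decide, by decide⟩
      exact hsep t' i j hij ((hcon i hi).trans (hcon j hj).symm)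
    have h1 := key hne hjc (hreach t' j)
    have h2 := hmax t (m t) _ (hsph t' j) (((hreach t (m t)).trans h.symm).trans h1)
    rw [hM] at h2
    exact hj (hMinj t' _ _ (henc (le_antisymm h2 (hm t' j))))
  rw [← Finset.card_attach]
  refine Finset.card_le_card_of_injOn (fun t => M t (m t)) (fun t _ => hsph t (m t)) ?_
  intro t _ t' _ hM
  by_contra hne
  have hM : M t (m t) = M t' (m t') := hM
  refine caseA t t' hne hM ?_
  by_contra h
  -- The chosen branch of `t` does not reach `K t'`, so it survives cutting `K t'` and joins `K t`
  -- to the common image: the excluded case with the roles exchanged.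
  refine caseA t' t (Ne.symm hne) hM.symm ?_
  rw [← hM]
  refine key (Ne.symm hne) (fun h' => h ?_) (hreach t (m t))
  exact h'.symm.trans (hreach t (m t))

end Counting

/-! ### Measurability of connection events -/

/-- The edges of an open path serve as `F`. This writes connection as a countable union of cylinder
events, whence its measurability. -/
lemma reachable_iff_exists_agreeEvent {ω : Config d} {x y : Vertex d} :
    (openGraph ω).Reachable x y ↔ ∃ F : Finset (Edge d), ω ∈ agreeEvent true F ∧
      (openGraph (openEdges (F : Set (Edge d)) fun _ => false)).Reachable x y := by
  classical
  have hmono : ∀ {F F' : Finset (Edge d)}, F ⊆ F' →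
      openGraph (openEdges (F : Set (Edge d)) fun _ => false) ≤
        openGraph (openEdges (F' : Set (Edge d)) fun _ => false) := fun {F F'} h =>
    openGraph_mono fun e => by
      by_cases he : e ∈ F
      · simp [openEdges, he, h he]
      · simp [openEdges, he, Bool.false_le]
  constructor
  · intro h
    rw [SimpleGraph.reachable_iff_reflTransGen] at h
    induction h with
    | refl => exact ⟨∅, by simp [agreeEvent], by rfl⟩
    | @tail u w _ hadj ih =>
      obtain ⟨F, hF, hr⟩ := ih
      obtain ⟨h1, h2⟩ := openGraph_adj.1 hadj
      refine ⟨insert ⟨s(u, w), h1⟩ F, ?_, (hr.mono (hmono (Finset.subset_insert _ _))).trans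
        (SimpleGraph.Adj.reachable (openGraph_adj.2 ⟨h1, ?_⟩))⟩
      · intro e he
        rcases Finset.mem_insert.1 he with rfl | he
        · exact h2
        · exact hF e he
      · simp [openEdges]
  · rintro ⟨F, hF, h⟩
    refine h.mono (openGraph_mono fun e => ?_)
    by_cases he : e ∈ F
    · simp [openEdges, he, hF e he]
    · simp [openEdges, he, Bool.false_le]

lemma measurable_reachable (x y : Vertex d) :
    Measurable fun ω : Config d => (openGraph ω).Reachable x y := by
  rw [funext fun ω : Config d => propext (reachable_iff_exists_agreeEvent (x := x) (y := y))]
  refine Measurable.exists fun F => Measurable.and ?_ measurable_const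
  exact measurableSet_setOfPred.1 (dependsOnFinitelyManyEdges_agreeEvent true F).measurableSet

lemma measurable_connectedToInfinity (x : Vertex d) :
    Measurable fun ω : Config d => ConnectedToInfinity ω x := by
  have : ∀ ω : Config d, ConnectedToInfinity ω x ↔
      ∀ T : Finset (Vertex d), ∃ y, y ∉ T ∧ (openGraph ω).Reachable x y := by
    intro ω
    rw [connectedToInfinity_iff]
    constructor
    · intro h T
      obtain ⟨y, hy, hyT⟩ := h.exists_notMem_finset T
      exact ⟨y, hyT, hy⟩
    · intro h hfin
      obtain ⟨y, hyT, hy⟩ := h hfin.toFinset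
      exact hyT (hfin.mem_toFinset.2 hy)
  simp only [this]
  exact Measurable.forall fun T => Measurable.exists fun y =>
    Measurable.and measurable_const (measurable_reachable x y)

lemma measurable_uniqueInfinite : Measurable (UniqueInfinite (d := d)) :=
  Measurable.exists fun x => (measurable_connectedToInfinity x).and <| Measurable.forall fun y =>
    (measurable_connectedToInfinity y).imp (measurable_reachable x y)

lemma measurable_cut (K : Finset (Vertex d)) : Measurable (cut (d := d) K) := by
  refine measurable_pi_lambda _ fun e => ?_
  by_cases h : e ∈ touching K
  · simp only [cut, h, if_true]; exact measurable_const
  · simp only [cut, h, if_false]; exact measurable_pi_apply e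

lemma measurableSet_trifurcation (K : Finset (Vertex d)) :
    MeasurableSet {ω : Config d | Trifurcation K ω} := by
  refine measurableSet_setOfPred.2 (Measurable.and ?_ (Measurable.exists fun v => Measurable.and
    measurable_const (Measurable.and (Measurable.forall fun i => ?_) (Measurable.forall fun i =>
      Measurable.forall fun j => Measurable.imp measurable_const (Measurable.not ?_)))))
  · refine Measurable.forall fun e => Measurable.imp measurable_const ?_
    exact measurableSet_setOfPred.1 (measurableSet_eq_fun (measurable_pi_apply e) measurable_const)
  · exact (measurable_connectedToInfinity (v i)).comp (measurable_cut K)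
  · exact (measurable_reachable (v i) (v j)).comp (measurable_cut K)

/-! ### Behaviour under translations -/

lemma reachable_pull {τ : lattice d ≃g lattice d} {ω : Config d} {x y : Vertex d} :
    (openGraph (pull τ ω)).Reachable x y ↔ (openGraph ω).Reachable (τ x) (τ y) := by
  let f : openGraph (pull τ ω) ≃g openGraph ω :=
    { toEquiv := τ.toEquiv, map_rel_iff' := fun {_ _} => openGraph_pull_adj.symm }
  exact (SimpleGraph.Iso.reachable_iff (φ := f)).symm

lemma connectedToInfinity_pull {τ : lattice d ≃g lattice d} {ω : Config d} {x : Vertex d} :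
    ConnectedToInfinity (pull τ ω) x ↔ ConnectedToInfinity ω (τ x) := by
  rw [connectedToInfinity_iff, connectedToInfinity_iff]
  have : {y | (openGraph ω).Reachable (τ x) y} =
      τ '' {y | (openGraph (pull τ ω)).Reachable x y} := by
    ext y
    obtain ⟨y, rfl⟩ := τ.surjective y
    rw [Set.mem_image]
    simp only [Set.mem_ofPred_eq, reachable_pull]
    exact ⟨fun h => ⟨y, h, rfl⟩, fun ⟨z, hz, h⟩ => h ▸ hz⟩
  rw [this, Set.infinite_image_iff τ.injective.injOn]

lemma exists_connectedToInfinity_pull {τ : lattice d ≃g lattice d} {ω : Config d} :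
    (∃ x, ConnectedToInfinity (pull τ ω) x) ↔ ∃ x, ConnectedToInfinity ω x := by
  simp only [connectedToInfinity_pull]
  exact (τ.surjective.exists (p := fun x => ConnectedToInfinity ω x)).symm

lemma uniqueInfinite_pull {τ : lattice d ≃g lattice d} {ω : Config d} :
    UniqueInfinite (pull τ ω) ↔ UniqueInfinite ω := by
  simp only [UniqueInfinite, connectedToInfinity_pull, reachable_pull]
  rw [τ.surjective.exists (p := fun x => ConnectedToInfinity ω x ∧ _)]
  refine exists_congr fun x => and_congr_right fun _ => ?_
  exact (τ.surjective.forall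
    (p := fun y => ConnectedToInfinity ω y → (openGraph ω).Reachable (τ x) y)).symm

lemma mapEdgeSet_mem_touching {τ : lattice d ≃g lattice d} {K : Finset (Vertex d)} {e : Edge d} :
    τ.mapEdgeSet e ∈ touching (K.map τ.toEquiv.toEmbedding) ↔ e ∈ touching K := by
  constructor
  · rintro ⟨x, hx, hxe⟩
    obtain ⟨y, hy, rfl⟩ := Finset.mem_map.1 hx
    exact ⟨y, hy, mem_mapEdgeSet.1 hxe⟩
  · rintro ⟨x, hx, hxe⟩
    exact ⟨τ x, Finset.mem_map_of_mem _ hx, mem_mapEdgeSet.2 hxe⟩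

lemma cut_pull (τ : lattice d ≃g lattice d) (K : Finset (Vertex d)) (ω : Config d) :
    cut K (pull τ ω) = pull τ (cut (K.map τ.toEquiv.toEmbedding) ω) := by
  funext e
  have h := mapEdgeSet_mem_touching (τ := τ) (K := K) (e := e)
  by_cases he : e ∈ touching K
  · simp only [cut, pull, if_pos he, if_pos (h.2 he)]
  · simp only [cut, pull, if_neg he, if_neg (mt h.1 he)]

lemma trifurcation_pull {τ : lattice d ≃g lattice d} {K : Finset (Vertex d)} {ω : Config d}
    (h : Trifurcation K (pull τ ω)) : Trifurcation (K.map τ.toEquiv.toEmbedding) ω := by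
  obtain ⟨h1, v, h2, h3, h4⟩ := h
  rw [cut_pull] at h3 h4
  refine ⟨(forall_edge_iff τ).2 fun e he => h1 e (mapEdgeSet_mem_touching.1 he),
    fun i => τ (v i), fun i => ?_, fun i => connectedToInfinity_pull.1 (h3 i),
    fun i j hij h => h4 i j hij (reachable_pull.2 h)⟩
  obtain ⟨k, hk, hkv⟩ := h2 i
  exact ⟨τ k, Finset.mem_map_of_mem _ hk, τ.map_adj_iff.2 hkv⟩

lemma induce_map_connected {τ : lattice d ≃g lattice d} {K : Finset (Vertex d)}
    (hK : ((lattice d).induce (K : Set (Vertex d))).Connected) :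
    ((lattice d).induce (K.map τ.toEquiv.toEmbedding : Set (Vertex d))).Connected := by
  let f : (lattice d).induce (K : Set (Vertex d)) →g
      (lattice d).induce (K.map τ.toEquiv.toEmbedding : Set (Vertex d)) :=
    { toFun := fun x => ⟨τ x.1, Finset.mem_coe.2 (Finset.mem_map_of_mem _ x.2)⟩
      map_rel' := fun {_ _} h => τ.map_adj_iff.2 h }
  refine hK.map f ?_
  rintro ⟨y, hy⟩
  obtain ⟨x, hx, rfl⟩ := Finset.mem_map.1 (Finset.mem_coe.1 hy)
  exact ⟨⟨x, hx⟩, rfl⟩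

/-! ### Trifurcations have probability zero -/

lemma card_boxVerts (n : ℕ) : (boxVerts d n).card = (2 * n + 1) ^ d := by
  unfold boxVerts
  rw [Pi.card_Icc]
  simp only [Int.card_Icc, Finset.prod_const, Finset.card_univ, Fintype.card_fin]
  congr 1
  omega

lemma card_sphere (n : ℕ) :
    ((sphere d n).card : ℝ) = (2 * (n : ℝ) + 3) ^ d - (2 * (n : ℝ) + 1) ^ d := by
  rw [sphere, Finset.card_sdiff_of_subset (boxVerts_monotone d (Nat.le_succ n)),
    Nat.cast_sub (Finset.card_le_card (boxVerts_monotone d (Nat.le_succ n))), card_boxVerts,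
    card_boxVerts]
  push_cast
  ring

theorem measure_trifurcation_eq_zero {φ : Measure (Config d)} [IsProbabilityMeasure φ]
    (hφ : ∀ τ : lattice d ≃g lattice d, MeasurePreserving (pull τ) φ φ) {K : Finset (Vertex d)}
    (hK : ((lattice d).induce (K : Set (Vertex d))).Connected) :
    φ {ω | Trifurcation K ω} = 0 := by
  classical
  obtain ⟨D, hD⟩ := exists_subset_boxVerts K
  -- The side of the box `Λ_D` containing `K`: translates by distinct multiples of `M` are disjoint,
  -- and the boxes tile `Λ_(D + M * L)`.
  set M : ℕ := 2 * D + 1 with hM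
  let τ : Vertex d → (lattice d ≃g lattice d) := fun y => shift ((M : ℤ) • y)
  let K' : Vertex d → Finset (Vertex d) := fun y => K.map (τ y).toEquiv.toEmbedding
  have hmem : ∀ {y x}, x ∈ K' y → ∃ k ∈ K, x = k + (M : ℤ) • y := by
    intro y x hx
    obtain ⟨k, hk, rfl⟩ := Finset.mem_map.1 hx
    exact ⟨k, hk, rfl⟩
  have hdisj : ∀ y y', y ≠ y' → Disjoint (K' y) (K' y') := by
    intro y y' hne
    rw [Finset.disjoint_left]
    intro x hx hx'
    obtain ⟨k, hk, rfl⟩ := hmem hx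
    obtain ⟨k', hk', h⟩ := hmem hx'
    refine hne (funext fun i => ?_)
    have h1 := mem_boxVerts.1 (hD hk) i
    have h2 := mem_boxVerts.1 (hD hk') i
    have h3 := congrFun h i
    simp only [Pi.add_apply, Pi.smul_apply, smul_eq_mul] at h3
    have h4 : (M : ℤ) * (y i - y' i) = k' i - k i := by linarith [mul_sub (M : ℤ) (y i) (y' i)]
    have h5 : |(M : ℤ) * (y i - y' i)| < M := by
      rw [h4, abs_lt, hM]
      push_cast
      constructor <;> linarith [h1.1, h1.2, h2.1, h2.2]
    have hMpos : (0 : ℤ) < M := by rw [hM]; positivity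
    rw [abs_mul, abs_of_pos hMpos] at h5
    have h6 : |y i - y' i| < 1 := by
      by_contra hcon
      push Not at hcon
      nlinarith
    have h7 := Int.abs_lt_one_iff.1 h6
    linarith
  have hbox : ∀ L, ∀ y ∈ boxVerts d L, K' y ⊆ boxVerts d (D + M * L) := by
    intro L y hy x hx
    obtain ⟨k, hk, rfl⟩ := hmem hx
    rw [mem_boxVerts]
    intro i
    have h1 := mem_boxVerts.1 (hD hk) i
    have h2 := mem_boxVerts.1 hy i
    have hMnn : (0 : ℤ) ≤ M := by positivity
    simp only [Pi.add_apply, Pi.smul_apply, smul_eq_mul]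
    push_cast
    constructor <;> nlinarith
  have hprob : ∀ y, φ {ω | Trifurcation K ω} ≤ φ {ω | Trifurcation (K' y) ω} := by
    intro y
    rw [← (hφ (τ y)).measure_preimage (measurableSet_trifurcation K).nullMeasurableSet]
    exact measure_mono fun ω hω => trifurcation_pull hω
  -- The left side is at most the expected number of translates of `K` that are trifurcations; the
  -- right side bounds that number pointwise.
  have hcount : ∀ L, (boxVerts d L).card * φ {ω | Trifurcation K ω} ≤
      (sphere d (D + M * L)).card := by
    intro L
    have hind : ∀ ω : Config d, ∑ y ∈ boxVerts d L,
        {ω | Trifurcation (K' y) ω}.indicator (1 : Config d → ENNReal) ω ≤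
          (sphere d (D + M * L)).card := by
      intro ω
      have h1 := card_trifurcation_le (ω := ω)
        ((boxVerts d L).filter fun y => Trifurcation (K' y) ω) K' (n := D + M * L)
        (fun y => induce_map_connected hK) (fun y _ y' _ => hdisj y y')
        (fun y hy => hbox L y (Finset.mem_filter.1 hy).1) (fun y hy => (Finset.mem_filter.1 hy).2)
      simp only [Set.indicator_apply, Set.mem_ofPred_eq, Pi.one_apply]
      rw [Finset.sum_boole]
      exact_mod_cast h1
    calc ((boxVerts d L).card : ENNReal) * φ {ω | Trifurcation K ω}
        = ∑ y ∈ boxVerts d L, φ {ω | Trifurcation K ω} := by simp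
      _ ≤ ∑ y ∈ boxVerts d L, φ {ω | Trifurcation (K' y) ω} :=
          Finset.sum_le_sum fun y _ => hprob y
      _ = ∫⁻ ω, ∑ y ∈ boxVerts d L,
            {ω | Trifurcation (K' y) ω}.indicator (1 : Config d → ENNReal) ω ∂φ := by
          rw [lintegral_finsetSum _ fun y _ => measurable_one.indicator (measurableSet_trifurcation _)]
          exact Finset.sum_congr rfl fun y _ =>
            (lintegral_indicator_one (measurableSet_trifurcation _)).symm
      _ ≤ ∫⁻ _, ((sphere d (D + M * L)).card : ENNReal) ∂φ := lintegral_mono hind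
      _ = _ := by simp
  set c := φ.real {ω | Trifurcation K ω} with hc
  -- Surface over number of translates: the outer and inner sides are `M * (2 * L + 1) + 2` and `M *
  -- (2 * L + 1)`, and the `d`-th powers are divided by `(2 * L + 1) ^ d`.
  have hreal : ∀ L : ℕ, c ≤ ((M : ℝ) + 2 / (2 * L + 1)) ^ d - (M : ℝ) ^ d := by
    intro L
    have h1 := ENNReal.toReal_mono (by finiteness) (hcount L)
    rw [ENNReal.toReal_mul, ENNReal.toReal_natCast, ENNReal.toReal_natCast, card_sphere,
      card_boxVerts] at h1
    push_cast at h1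
    have hm : (0 : ℝ) < 2 * L + 1 := by positivity
    have e1 : 2 * ((D : ℝ) + M * L) + 1 = M * (2 * L + 1) := by rw [hM]; push_cast; ring
    have e2 : 2 * ((D : ℝ) + M * L) + 3 = (M + 2 / (2 * L + 1)) * (2 * L + 1) := by
      field_simp
      linarith
    rw [e1, e2, mul_pow, mul_pow, ← sub_mul, mul_comm] at h1
    exact le_of_mul_le_mul_right h1 (by positivity)
  have hlim : Tendsto (fun L : ℕ => ((M : ℝ) + 2 / (2 * L + 1)) ^ d - (M : ℝ) ^ d) atTop (𝓝 0) := by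
    have h1 : Tendsto (fun L : ℕ => 2 / (2 * (L : ℝ) + 1)) atTop (𝓝 0) := by
      refine Tendsto.div_atTop tendsto_const_nhds ?_
      exact tendsto_atTop_add_const_right _ _
        (tendsto_natCast_atTop_atTop.const_mul_atTop (by norm_num))
    have h2 := ((h1.const_add (M : ℝ)).pow d).sub_const ((M : ℝ) ^ d)
    simpa using h2
  have hc0 : c = 0 := le_antisymm (ge_of_tendsto' hlim hreal) measureReal_nonneg
  exact (measureReal_eq_zero_iff).1 hc0

/-! ### The theorem -/

section Main

variable {b : BoundaryType} {p q : ℝ} {φ : Measure (Config d)} [IsProbabilityMeasure φ]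

omit [IsProbabilityMeasure φ] in
-- Handles `p = 0`, where insertion tolerance fails.
lemma ae_closed_of_zero (hq : 1 ≤ q)
    (hφ : ∀ A, DependsOnFinitelyManyEdges A → φ A = ENNReal.ofReal (limitProb b 0 q A)) :
    ∀ᵐ ω ∂φ, ∀ e : Edge d, ω e = false := by
  have hp : (0 : ℝ) ∈ Set.Icc (0 : ℝ) 1 := by simp
  rw [ae_all_iff]
  intro e
  have hdep : DependsOnFinitelyManyEdges {ω : Config d | ¬ ω e = false} :=
    ⟨{e}, fun ω ω' h => by simp [h e (by simp)]⟩
  have hlim : limitProb b 0 q {ω : Config d | ¬ ω e = false} = 0 := by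
    refine tendsto_nhds_unique (tendsto_limitProb hp hq hdep) (tendsto_const_nhds.congr' ?_)
    filter_upwards [eventually_ge_atTop {e}] with S hS
    have he : e ∈ S := Finset.singleton_subset_iff.1 hS
    rw [prob, rcSum_eq_sum_indicator, Finset.sum_eq_zero, zero_div]
    intro ω _
    rw [Set.indicator_apply_eq_zero]
    intro hω
    have hω : ω e = true := by simpa using hω
    rw [rcWeight, Finset.prod_eq_zero he, zero_mul]
    simp [edgeWeight, hω]
  rw [ae_iff, hφ _ hdep, hlim, ENNReal.ofReal_zero]

theorem infinite_cluster_dichotomy (hd : 1 ≤ d) (hp : p ∈ Set.Icc (0 : ℝ) 1) (hq : 1 ≤ q)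
    (hφ : ∀ A, DependsOnFinitelyManyEdges A → φ A = ENNReal.ofReal (limitProb b p q A)) :
    (∀ᵐ ω ∂φ, ¬ ∃ x, ConnectedToInfinity ω x) ∨ ∀ᵐ ω ∂φ, UniqueInfinite ω := by
  have hpull := measurePreserving_pull hp hq hφ
  rcases hp.1.eq_or_lt with rfl | hp0
  · left
    filter_upwards [ae_closed_of_zero hq hφ] with ω hω
    rintro ⟨x, hx⟩
    rw [connectedToInfinity_iff] at hx
    refine hx ((Set.finite_singleton x).subset fun y hy => ?_)
    have hbot : openGraph ω = ⊥ := by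
      ext u v
      simp [openGraph_adj, hω]
    rw [Set.mem_ofPred_eq, hbot, SimpleGraph.reachable_bot] at hy
    exact hy.symm
  rcases measure_eq_zero_or_one_of_invariant hp hq hφ hd
    (measurableSet_setOfPred.2 (Measurable.exists fun x => measurable_connectedToInfinity x))
    (fun x => by ext ω; exact exists_connectedToInfinity_pull) with h | hinf
  · exact Or.inl (measure_eq_zero_iff_ae_notMem.1 h)
  rcases measure_eq_zero_or_one_of_invariant hp hq hφ hd
    (measurableSet_setOfPred.2 measurable_uniqueInfinite)
    (fun x => by ext ω; exact uniqueInfinite_pull) with h | h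
  · exfalso
    have h1 : ∀ᵐ ω ∂φ, ∃ x, ConnectedToInfinity ω x := (mem_ae_iff_prob_eq_one
      (measurableSet_setOfPred.2 (Measurable.exists fun x => measurable_connectedToInfinity x))).2 hinf
    have h2 := ae_forall_openEdges hp hq hφ hp0 (measure_eq_zero_iff_ae_notMem.1 h)
    have h3 : ∀ᵐ ω ∂φ, ∀ K : Finset (Vertex d),
        ((lattice d).induce (K : Set (Vertex d))).Connected → ¬ Trifurcation K ω :=
      ae_all_iff.2 fun K => by
        by_cases hK : ((lattice d).induce (K : Set (Vertex d))).Connected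
        · filter_upwards [measure_eq_zero_iff_ae_notMem.1 (measure_trifurcation_eq_zero hpull hK)]
            with ω hω _ using hω
        · exact Eventually.of_forall fun ω h => absurd h hK
    have h4 := ae_forall_openEdges hp hq hφ hp0 h3
    -- A configuration with an infinite cluster for which opening a finite edge set never creates a
    -- unique infinite cluster nor a trifurcation; `exists_trifurcation_join` rules this out.
    obtain ⟨ω, hω1, hω2, hω4⟩ := (h1.and (h2.and h4)).exists
    have hjoin : ∀ K : Finset (Vertex d), openEdges ((finite_touching K).toFinset : Set (Edge d)) ω =
        join K ω := fun K => by rw [Set.Finite.coe_toFinset]; rfl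
    obtain ⟨K, hK, htri⟩ := exists_trifurcation_join hω1 fun K hU =>
      hω2 (finite_touching K).toFinset (by rw [hjoin]; exact hU)
    exact hω4 (finite_touching K).toFinset K hK (by rw [hjoin]; exact htri)
  · exact Or.inr ((mem_ae_iff_prob_eq_one (measurableSet_setOfPred.2 measurable_uniqueInfinite)).2 h)

end Main

end RandomCluster

open RandomCluster in
theorem mainTheorem10 (d : ℕ) (hd : 1 ≤ d) (p q : ℝ) (hp : p ∈ Set.Icc (0 : ℝ) 1) (hq : 1 ≤ q)
    (b : RandomCluster.BoundaryType) :
    (∃! φ : Measure (RandomCluster.Config d), RandomCluster.IsInfiniteVolumeMeasure b p q φ) ∧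
    ∀ φ : Measure (RandomCluster.Config d), RandomCluster.IsInfiniteVolumeMeasure b p q φ →
      (φ {ω | RandomCluster.ConnectedToInfinity ω 0} = 0 ∧
        ∀ᵐ ω ∂φ, ¬ ∃ C : RandomCluster.Cluster ω, C.supp.Infinite) ∨
      (∀ᵐ ω ∂φ, ∃! C : RandomCluster.Cluster ω, C.supp.Infinite) := by
  refine ⟨existsUnique_isInfiniteVolumeMeasure hp hq hd b, fun φ hφ => ?_⟩
  obtain ⟨hprob, hφ⟩ := (isInfiniteVolumeMeasure_iff hp hq hd).1 hφ
  refine (infinite_cluster_dichotomy hd hp hq hφ).imp (fun h => ⟨?_, ?_⟩) fun h => ?_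
  · rw [measure_eq_zero_iff_ae_notMem]
    filter_upwards [h] with ω hω h0 using hω ⟨0, h0⟩
  · filter_upwards [h] with ω hω
    rintro ⟨C, hC⟩
    induction C using SimpleGraph.ConnectedComponent.ind with
    | h x => exact hω ⟨x, hC⟩
  · filter_upwards [h] with ω hω using existsUnique_cluster hω
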